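/- **Setting.** Let $\mathbb W=\{x\in\prod_{n\in\mathbb Z}\mathbb Z/3\mathbb Z : [x]_n=0 \text{ for } n \text{ large}\}$ be the $3$-Walsh group with digitwise addition, the metric $|x-y|$, where $|x|=\max\{3^n:[x]_n\neq0\}$ and $|0|=0$, and the Haar measure normalised by $|B_1(0)|=1$. An interval is a ball $B_{3^n}(x)=\{y:|x-y|<3^n\}$, of measure $3^n$; its children are $\mathrm{ch}_j(I)=\{x\in I:[x]_{n-1}=j\}$, $j\in\{0,1,2\}$. A tile (tritile) is a rectangle $P=I_P\times\omega_P\subset\mathbb W\times\mathbb W$ of area $1$ (area $3$) whose sides are intervals; a tritile $\mathbf P$ is split into the tiles $\mathbf P_u=I_{\mathbf P}\times\mathrm{ch}_u(\omega_{\mathbf P})$, $u\in\{0,1,2\}$. Let $\xi_P$ be the point of $\omega_P$ all of whose digits $[\xi_P]_j$ with $3^j<|\omega_P|$ are $0$, let $\exp_\xi(x)=(e^{2\pi i/3})^{\sum_{j+k=-1}[\xi]_j[x]_k}$, and $w_P=|I_P|^{-1}\exp_{\xi_P}\mathbf 1_{I_P}$. Let $X$ be a complex Banach space. A function $f:\mathbb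 W\to X$ is Schwartz, $f\in\mathscr S(\mathbb W;X)$, if for some $N>0$ it is supported in $B_{3^N}(0)$ and constant on every interval of measure less than $3^{-N}$. Put $$\mathcal E[f](\mathbf P)=\Big(\int_{\mathbb W} f(x)\,w_{\mathbf P_u}(x)\,dx\Big)_{u\in\{0,1,2\}}\in X^3,\qquad \|(x_0,x_1,x_2)\|_{X^3}=\max_u\|x_u\|_X .$$ For a tritile $\mathbf P$ let $T(\mathbf P)$ be the tree of all tritiles $\mathbf Q$ with $I_{\mathbf Q}\subseteq I_{\mathbf P}$ and $\omega_{\mathbf Q}\supseteq\omega_{\mathbf P}$. For a set $A$ of tritiles let $\mu(A)$ be the infimum of $\sum_{k}|I_{\mathbf P_k}|$ over all countable covers of $A$ by trees $T(\mathbf P_k)$. For a $\mathbb C$-valued function $F$ of tritiles put $\|F\|_{S^\infty}=\sup_T\sup_{\mathbf P\in T}|F(\mathbf P)|$ (supremum over all trees $T$), $\mu(\|F\|_{S^\infty}>\lambda)=\inf\{\mu(A):\|\mathbf 1_{A^c}F\|_{S^\infty}\le\lambda\}$ for $\lambda>0$, and $$\|F\|_{L^p_\mu S^\infty}=\Big(\int_0^\infty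 p\lambda^{p-1}\mu(\|F\|_{S^\infty}>\lambda)\,d\lambda\Big)^{1/p}\ (p<\infty),\quad \|F\|_{L^\infty_\mu S^\infty}=\|F\|_{S^\infty},\quad \|F\|_{L^{p,\infty}_\mu S^\infty}=\sup_{\lambda>0}\lambda\,\mu(\|F\|_{S^\infty}>\lambda)^{1/p}\ (p<\infty).$$ For $r\in[2,\infty)$, $X$ is called $r$-Hilbertian if it is isomorphic to a complex interpolation space $[H,Y]_\theta$ of an interpolation couple of a Hilbert space $H$ and a Banach space $Y$, where $\frac1r=\frac{1-\theta}2$, $\theta\in[0,1]$. **Theorem.** Let $X$ be a complex Banach space which is $r$-Hilbertian for some $r\in[2,\infty)$. Then for every $p\in(r,\infty]$ there is a constant $C=C(X,r,p)$ such that $$\big\|\,\|\mathcal E[f]\|_{X^3}\big\|_{L^p_\mu S^\infty}\le C\,\|f\|_{L^p(\mathbb W;X)}\qquad\text{for all } f\in\mathscr S(\mathbb W;X),$$ and there is a constant $C=C(X,r)$ such that $$\big\|\,\|\mathcal E[f]\|_{X^3}\big\|_{L^{r,\infty}_\mu S^\infty}\le C\,\|f\|_{L^r(\mathbb W;X)}\qquad\text{for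 all } f\in\mathscr S(\mathbb W;X).$$ -/

import Mathlib

open scoped ENNReal BoundedContinuousFunction
open MeasureTheory Set

universe u v

noncomputable section

/-! ### The 3-Walsh group -/

/-- The sequences of digits in `ℤ/3ℤ` indexed by `ℤ` that vanish for all large indices. -/
def walshSubgroup : AddSubgroup (ℤ → ZMod 3) where
  carrier := {x | ∃ N : ℤ, ∀ n, N ≤ n → x n = 0}
  zero_mem' := ⟨0, fun _ _ => rfl⟩
  add_mem' := by
    rintro x y ⟨N, hN⟩ ⟨M, hM⟩
    refine ⟨max N M, fun n hn => ?_⟩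
    simp [hN n (le_trans (le_max_left _ _) hn), hM n (le_trans (le_max_right _ _) hn)]
  neg_mem' := by
    rintro x ⟨N, hN⟩
    exact ⟨N, fun n hn => by simp [hN n hn]⟩

/-- The 3-Walsh group, with digitwise addition. It is a type of its own, so that it does not
inherit the topology of the product. -/
def Walsh : Type := walshSubgroup

namespace Walsh

instance : AddCommGroup Walsh := inferInstanceAs (AddCommGroup walshSubgroup)

/-- The `n`-th digit of `x`. -/
def digit (x : Walsh) (n : ℤ) : ZMod 3 := x.1 n

theorem ext_digit {x y : Walsh} (h : ∀ n, x.digit n = y.digit n) : x = y :=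
  Subtype.ext (funext h)

@[simp] theorem digit_zero (n : ℤ) : digit 0 n = 0 := rfl
@[simp] theorem digit_add (x y : Walsh) (n : ℤ) : (x + y).digit n = x.digit n + y.digit n := rfl
@[simp] theorem digit_neg (x : Walsh) (n : ℤ) : (-x).digit n = -x.digit n := rfl
@[simp] theorem digit_sub (x y : Walsh) (n : ℤ) : (x - y).digit n = x.digit n - y.digit n := rfl

/-- `|x| = max {3 ^ n : the n-th digit of x is not 0}`, and `|0| = 0`. -/
def absval (x : Walsh) : ℝ := sSup ((fun n : ℤ => (3 : ℝ) ^ n) '' {n | x.digit n ≠ 0})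

theorem bddAbove_absval (x : Walsh) :
    BddAbove ((fun n : ℤ => (3 : ℝ) ^ n) '' {n | x.digit n ≠ 0}) := by
  obtain ⟨N, hN⟩ := x.2
  refine ⟨3 ^ N, ?_⟩
  rintro _ ⟨n, hn, rfl⟩
  refine zpow_le_zpow_right₀ (by norm_num) ?_
  by_contra! h
  exact hn (hN n h.le)

theorem absval_nonneg (x : Walsh) : 0 ≤ absval x := by
  apply Real.sSup_nonneg
  rintro _ ⟨n, -, rfl⟩
  positivity

theorem le_absval {x : Walsh} {n : ℤ} (h : x.digit n ≠ 0) : (3 : ℝ) ^ n ≤ absval x :=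
  le_csSup (bddAbove_absval x) ⟨n, h, rfl⟩

theorem absval_le {x : Walsh} {C : ℝ} (hC : 0 ≤ C) (h : ∀ n, x.digit n ≠ 0 → (3 : ℝ) ^ n ≤ C) :
    absval x ≤ C := by
  apply Real.sSup_le _ hC
  rintro _ ⟨n, hn, rfl⟩
  exact h n hn

theorem absval_add_le_max (x y : Walsh) : absval (x + y) ≤ max (absval x) (absval y) := by
  refine absval_le (le_max_of_le_left (absval_nonneg x)) fun n hn => ?_
  by_cases hx : x.digit n = 0
  · have hy : y.digit n ≠ 0 := fun hy => hn (by simp [hx, hy])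
    exact le_max_of_le_right (le_absval hy)
  · exact le_max_of_le_left (le_absval hx)

/-- The metric on the Walsh group is `(x, y) ↦ |x - y|`. -/
instance : NormedAddCommGroup Walsh :=
  AddGroupNorm.toNormedAddCommGroup
    { toFun := absval
      map_zero' := by simp [absval]
      add_le' := fun x y => (absval_add_le_max x y).trans
        (max_le_add_of_nonneg (absval_nonneg x) (absval_nonneg y))
      neg' := fun x => by simp [absval]
      eq_zero_of_map_eq_zero' := fun x hx => by
        refine ext_digit fun n => ?_
        by_contra h
        have h1 := le_absval h
        have h2 : (0 : ℝ) < 3 ^ n := by positivity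
        have h3 : absval x = 0 := hx
        linarith }

theorem norm_def (x : Walsh) : ‖x‖ = absval x := rfl

theorem norm_lt_zpow_iff {x : Walsh} {n : ℤ} :
    ‖x‖ < (3 : ℝ) ^ n ↔ ∀ j, n ≤ j → x.digit j = 0 := by
  rw [norm_def]
  constructor
  · intro h j hj
    by_contra hx
    exact absurd (le_absval hx) (not_le.mpr
      (h.trans_le (zpow_le_zpow_right₀ (by norm_num) hj)))
  · intro h
    refine lt_of_le_of_lt (absval_le (C := 3 ^ (n - 1)) (by positivity) fun j hj => ?_)
      (zpow_lt_zpow_right₀ (by norm_num) (by omega))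
    refine zpow_le_zpow_right₀ (by norm_num) ?_
    by_contra! hlt
    exact hj (h j (by omega))

instance : MeasurableSpace Walsh := borel Walsh
instance : BorelSpace Walsh := ⟨rfl⟩

/-- The point with digits `a 0, a 1, a 2, …` at the places `-1, -2, -3, …`, all others `0`. -/
def ofNegDigits (a : ℕ → ZMod 3) : Walsh :=
  ⟨fun n => if n < 0 then a (-1 - n).toNat else 0, ⟨0, fun n hn => if_neg (by omega)⟩⟩

theorem isCompact_unitBall : IsCompact (Metric.ball (0 : Walsh) 1) := by
  let _ : TopologicalSpace (ZMod 3) := ⊥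
  have : DiscreteTopology (ZMod 3) := ⟨rfl⟩
  have himg : ofNegDigits '' univ = Metric.ball (0 : Walsh) 1 := by
    ext x
    have h1 : x ∈ Metric.ball (0 : Walsh) 1 ↔ ∀ j, 0 ≤ j → x.digit j = 0 := by
      rw [mem_ball_zero_iff, ← norm_lt_zpow_iff, zpow_zero]
    rw [h1]
    constructor
    · rintro ⟨a, -, rfl⟩ j hj
      exact if_neg (by omega)
    · intro h
      refine ⟨fun k => x.digit (-1 - k), mem_univ _, ext_digit fun n => ?_⟩
      by_cases hn : n < 0
      · have : (ofNegDigits fun k => x.digit (-1 - k)).digit n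
            = x.digit (-1 - ((-1 - n).toNat : ℕ)) := if_pos hn
        rw [this]
        congr 1
        omega
      · rw [h n (by omega)]
        exact if_neg hn
  rw [← himg]
  refine isCompact_univ.image ?_
  rw [continuous_iff_continuousAt]
  intro a
  rw [ContinuousAt, Metric.tendsto_nhds]
  intro ε hε
  obtain ⟨K, hK⟩ := exists_pow_lt_of_lt_one hε (by norm_num : (1 / 3 : ℝ) < 1)
  have hev : ∀ᶠ b in nhds a, ∀ k ∈ Finset.range K, b k = a k := by
    rw [Filter.eventually_all_finset]
    intro k _
    have : Filter.Tendsto (fun b : ℕ → ZMod 3 => b k) (nhds a) (nhds (a k)) :=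
      (continuous_apply k).tendsto a
    rw [nhds_discrete (ZMod 3), Filter.tendsto_pure] at this
    exact this
  filter_upwards [hev] with b hb
  rw [dist_eq_norm]
  refine lt_trans ?_ hK
  have : ((1 / 3 : ℝ)) ^ K = 3 ^ (-(K : ℤ)) := by
    rw [zpow_neg, zpow_natCast, one_div, inv_pow]
  rw [this, norm_lt_zpow_iff]
  intro j hj
  rw [digit_sub]
  by_cases hn : j < 0
  · have h1 : ∀ c, (ofNegDigits c).digit j = c (-1 - j).toNat := fun c => if_pos hn
    rw [h1, h1, hb _ (Finset.mem_range.mpr (by omega)), sub_self]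
  · have h1 : ∀ c, (ofNegDigits c).digit j = 0 := fun c => if_neg hn
    rw [h1, h1, sub_self]

/-- The ball `B_1(0)`, a compact set with non-empty interior. -/
def unitBall : TopologicalSpace.PositiveCompacts Walsh where
  carrier := Metric.ball 0 1
  isCompact' := isCompact_unitBall
  interior_nonempty' := by
    rw [Metric.isOpen_ball.interior_eq]
    exact Metric.nonempty_ball.mpr one_pos

/-- The Haar measure on the Walsh group, normalised by `|B_1(0)| = 1`. -/
instance : MeasureSpace Walsh := ⟨Measure.addHaarMeasure unitBall⟩

/-- The pairing `∑_{j + k = -1} ξ_j x_k` of two points (only finitely many terms are not `0`). -/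
def dot (ξ x : Walsh) : ZMod 3 := ∑ᶠ j : ℤ, ξ.digit j * x.digit (-1 - j)

/-- The Walsh exponential `exp_ξ(x) = (e^{2πi/3})^{∑_{j + k = -1} ξ_j x_k}`. -/
def expw (ξ x : Walsh) : ℂ := Complex.exp (2 * Real.pi * Complex.I / 3) ^ (dot ξ x).val

/-- The point whose `n`-th digit is `a` and whose other digits are `0`. -/
def single (n : ℤ) (a : ZMod 3) : Walsh :=
  ⟨fun m => if m = n then a else 0, ⟨n + 1, fun m hm => if_neg (by omega)⟩⟩

theorem single_digit (n : ℤ) (a : ZMod 3) (m : ℤ) :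
    (single n a).digit m = if m = n then a else 0 := rfl

instance : (volume : Measure Walsh).IsAddHaarMeasure :=
  inferInstanceAs (Measure.addHaarMeasure unitBall).IsAddHaarMeasure

theorem volume_unit : volume (Metric.ball (0 : Walsh) 1) = 1 :=
  Measure.addHaarMeasure_self

theorem vol_ball (x : Walsh) (r : ℝ) : volume (Metric.ball x r) = volume (Metric.ball (0:Walsh) r) := by
  have := measure_preimage_add (volume : Measure Walsh) (-x) (Metric.ball (0:Walsh) r)
  rw [← this]; congr 1; ext y; simp [dist_eq_norm, neg_add_eq_sub]

theorem vol_succ (n : ℤ) : volume (Metric.ball (0 : Walsh) ((3:ℝ)^(n+1))) = 3 * volume (Metric.ball (0 : Walsh) ((3:ℝ)^n)) := by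
  have h : Metric.ball (0 : Walsh) ((3:ℝ)^(n+1)) = ⋃ a ∈ (Finset.univ : Finset (ZMod 3)), Metric.ball (single n a) ((3:ℝ)^n) := by
    ext y
    simp only [mem_iUnion, mem_ball_iff_norm, sub_zero, norm_lt_zpow_iff, digit_sub, single_digit, sub_eq_zero]
    constructor
    · intro h
      refine ⟨y.digit n, Finset.mem_univ _, fun j hj => ?_⟩
      split_ifs with h1
      · rw [h1]
      · exact h j (by omega)
    · rintro ⟨a, -, h⟩ j hj
      rw [h j (by omega), if_neg (by omega)]
  rw [h, measure_biUnion_finset]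
  · simp only [vol_ball (single n _)]
    simp
  · intro a _ b _ hab
    refine Set.disjoint_left.mpr fun y hy hy' => hab ?_
    simp only [mem_ball_iff_norm, norm_lt_zpow_iff, digit_sub, single_digit, sub_eq_zero] at hy hy'
    have h1 := hy n le_rfl
    have h2 := hy' n le_rfl
    simp at h1 h2
    rw [← h1, ← h2]
  · intro a _; exact Metric.isOpen_ball.measurableSet

theorem vol_zpow (n : ℤ) : volume (Metric.ball (0 : Walsh) ((3:ℝ)^n)) = ENNReal.ofReal (3^n) := by
  have h3 : (3 : ℝ≥0∞) = ENNReal.ofReal 3 := by simp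
  induction n using Int.induction_on with
  | zero => simp [volume_unit]
  | succ k ih =>
    rw [vol_succ, ih, h3, ← ENNReal.ofReal_mul (by norm_num), zpow_add_one₀ (by norm_num), mul_comm]
  | pred k ih =>
    have := vol_succ (-(k:ℤ) - 1)
    rw [sub_add_cancel, ih] at this
    have e : (3:ℝ) ^ (-(k:ℤ)) = 3 * 3 ^ (-(k:ℤ) - 1) := by
      rw [← zpow_one_add₀ (by norm_num)]; congr 1; ring
    rw [e, ENNReal.ofReal_mul (by norm_num), ← h3] at this
    exact ((ENNReal.mul_right_inj (by norm_num) (by norm_num)).mp this).symm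

end Walsh

/-! ### Intervals, tiles, tritiles -/

/-- An interval of the Walsh group, i.e. a ball `B_{3^n}(x)`, given by its scale `n` and its
unique centre `x` whose digits below `n` vanish. -/
@[ext] structure WalshInterval where
  scale : ℤ
  center : Walsh
  center_low : ∀ j, j < scale → center.digit j = 0

namespace WalshInterval

/-- The interval as a set of points. -/
def toSet (I : WalshInterval) : Set Walsh := Metric.ball I.center ((3 : ℝ) ^ I.scale)

/-- The measure `|I| = |B_{3^n}(x)| = 3^n` of an interval. -/
def length (I : WalshInterval) : ℝ := (3 : ℝ) ^ I.scale

theorem mem_toSet {I : WalshInterval} {x : Walsh} :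
    x ∈ I.toSet ↔ ∀ j, I.scale ≤ j → x.digit j = I.center.digit j := by
  rw [toSet, mem_ball_iff_norm, Walsh.norm_lt_zpow_iff]
  simp only [Walsh.digit_sub, sub_eq_zero]

theorem volume_toSet (I : WalshInterval) : volume I.toSet = ENNReal.ofReal I.length := by
  rw [toSet, Walsh.vol_ball, Walsh.vol_zpow, length]

/-- The child `ch_j(I)` of `I`: the points of `I` whose digit at place `log₃ |I| - 1` is `j`. -/
def child (I : WalshInterval) (j : ZMod 3) : WalshInterval where
  scale := I.scale - 1
  center := I.center + Walsh.single (I.scale - 1) j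
  center_low := fun k hk => by
    have h : (Walsh.single (I.scale - 1) j).digit k = 0 := if_neg (by omega)
    rw [Walsh.digit_add, I.center_low k (by omega), h, add_zero]

theorem mem_toSet_child {I : WalshInterval} {j : ZMod 3} {x : Walsh} :
    x ∈ (I.child j).toSet ↔ x ∈ I.toSet ∧ x.digit (I.scale - 1) = j := by
  have h1 : ∀ k, (I.child j).center.digit k
      = I.center.digit k + if k = I.scale - 1 then j else 0 := fun k => rfl
  have h2 : (I.child j).scale = I.scale - 1 := rfl
  simp only [mem_toSet, h1, h2]
  constructor
  · intro h
    refine ⟨fun k hk => ?_, ?_⟩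
    · rw [h k (by omega), if_neg (by omega), add_zero]
    · rw [h _ le_rfl, if_pos rfl, I.center_low _ (by omega), zero_add]
  · rintro ⟨h, hj⟩ k hk
    by_cases hk' : k = I.scale - 1
    · subst hk'
      rw [hj, if_pos rfl, I.center_low _ (by omega), zero_add]
    · rw [h k (by omega), if_neg hk', add_zero]

end WalshInterval

/-- A tile: a rectangle `I × ω` of area `1` whose sides are intervals. -/
@[ext] structure WalshTile where
  time : WalshInterval
  freq : WalshInterval
  area : time.scale + freq.scale = 0

/-- The wave packet `w_P(x) = |I_P|⁻¹ exp_{ξ_P}(x) 1_{I_P}(x)` of a tile `P`. -/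
def WalshTile.wavePacket (P : WalshTile) : Walsh → ℂ :=
  P.time.toSet.indicator fun x => ((P.time.length : ℂ))⁻¹ * Walsh.expw P.freq.center x

/-- A tritile: a rectangle `I × ω` of area `3` whose sides are intervals. -/
@[ext] structure Tritile where
  time : WalshInterval
  freq : WalshInterval
  area : time.scale + freq.scale = 1

namespace Tritile

/-- The tile `P_u = I_P × ch_u(ω_P)` of a tritile `P`. -/
def tile (P : Tritile) (u : ZMod 3) : WalshTile where
  time := P.time
  freq := P.freq.child u
  area := by
    have h := P.area
    show P.time.scale + (P.freq.scale - 1) = 0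
    omega

/-- `Q ≤ P` if `I_Q ⊆ I_P` and `ω_P ⊆ ω_Q`. -/
instance : LE Tritile :=
  ⟨fun Q P => Q.time.toSet ⊆ P.time.toSet ∧ P.freq.toSet ⊆ Q.freq.toSet⟩

/-- The tree `T(P)` with top `P`. -/
def tree (P : Tritile) : Set Tritile := {Q | Q ≤ P}

end Tritile

/-! ### Schwartz functions and the embedding -/

/-- Schwartz functions on the Walsh group. -/
def IsWalshSchwartz {X : Type*} [NormedAddCommGroup X] (f : Walsh → X) : Prop :=
  ∃ N : ℕ, 0 < N ∧ (∀ x, x ∉ Metric.ball (0 : Walsh) ((3 : ℝ) ^ N) → f x = 0) ∧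
    ∀ I : WalshInterval, I.length < (3 : ℝ) ^ (-(N : ℤ)) →
      ∀ x ∈ I.toSet, ∀ y ∈ I.toSet, f x = f y

/-- `⟨f; g⟩ = ∫ f(x) g(x) dx`, without complex conjugation. -/
def walshPairing {X : Type*} [NormedAddCommGroup X] [NormedSpace ℂ X]
    (f : Walsh → X) (g : Walsh → ℂ) : X := ∫ x, g x • f x

/-- The embedding `E[f](P) = (⟨f; w_{P_u}⟩)_{u ∈ {0,1,2}}`, with values in `X³`. -/
def embedding {X : Type*} [NormedAddCommGroup X] [NormedSpace ℂ X]
    (f : Walsh → X) (P : Tritile) : ZMod 3 → X :=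
  fun u => walshPairing f (P.tile u).wavePacket

/-! ### Outer `L^p` quasinorms

The generating sets are given as a family `E i`, with premeasure `σ i`. A size is a family of
`[0,∞]`-valued maps `S i` on functions. -/

section Outer

variable {ι 𝕏 V : Type*}

/-- The outer measure induced by the premeasure `σ` on the generating sets `E i`: the infimum
of `∑ σ i` over the countable covers by generating sets. -/
def inducedOuter (E : ι → Set 𝕏) (σ : ι → ℝ≥0∞) (A : Set 𝕏) : ℝ≥0∞ :=
  ⨅ (B : Set ι) (_ : B.Countable) (_ : A ⊆ ⋃ i ∈ B, E i), ∑' i : B, σ i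

/-- `‖F‖_S = sup_E ‖F‖_{S(E)}`. -/
def sizeNorm (S : ι → (𝕏 → V) → ℝ≥0∞) (F : 𝕏 → V) : ℝ≥0∞ := ⨆ i, S i F

variable [Zero V]

/-- The outer superlevel measure `σ(‖F‖_S > t)`. -/
def superlevel (E : ι → Set 𝕏) (σ : ι → ℝ≥0∞) (S : ι → (𝕏 → V) → ℝ≥0∞)
    (F : 𝕏 → V) (t : ℝ) : ℝ≥0∞ :=
  ⨅ (A : Set 𝕏) (_ : sizeNorm S (Aᶜ.indicator F) ≤ ENNReal.ofReal t), inducedOuter E σ A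

/-- The outer `L^p` quasinorm, `0 < p ≤ ∞`. -/
def outerLp (E : ι → Set 𝕏) (σ : ι → ℝ≥0∞) (S : ι → (𝕏 → V) → ℝ≥0∞)
    (p : ℝ≥0∞) (F : 𝕏 → V) : ℝ≥0∞ :=
  if p = ∞ then sizeNorm S F
  else (∫⁻ t in Ioi (0 : ℝ), ENNReal.ofReal (p.toReal * t ^ (p.toReal - 1)) *
    superlevel E σ S F t) ^ (1 / p.toReal)

/-- The weak outer `L^p` quasinorm, `0 < p < ∞`. -/
def weakOuterLp (E : ι → Set 𝕏) (σ : ι → ℝ≥0∞) (S : ι → (𝕏 → V) → ℝ≥0∞)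
    (p : ℝ) (F : 𝕏 → V) : ℝ≥0∞ :=
  ⨆ (t : ℝ) (_ : 0 < t), ENNReal.ofReal t * superlevel E σ S F t ^ (1 / p)

end Outer

/-- The premeasure `μ(T) = |I_T|` of the tree with top `P`. -/
def treePremeasure (P : Tritile) : ℝ≥0∞ := ENNReal.ofReal P.time.length

/-- The deterministic size `‖F‖_{S^∞(T)} = sup_{P ∈ T} |F(P)|`. -/
def sizeSup (T : Tritile) (F : Tritile → ℂ) : ℝ≥0∞ := ⨆ P ∈ T.tree, ‖F P‖ₑ

/-- The quasinorm of `L^p_μ S^∞` on functions of tritiles. -/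
def treeLp (p : ℝ≥0∞) (F : Tritile → ℂ) : ℝ≥0∞ :=
  outerLp Tritile.tree treePremeasure sizeSup p F

/-- The quasinorm of `L^{p,∞}_μ S^∞` on functions of tritiles. -/
def treeWeakLp (p : ℝ) (F : Tritile → ℂ) : ℝ≥0∞ :=
  weakOuterLp Tritile.tree treePremeasure sizeSup p F

/-! ### Complex interpolation and `r`-Hilbertian spaces -/

/-- An interpolation couple: two normed spaces (complete, where this is used) embedded
continuously into a common topological vector space (Hausdorff, where this is used). -/
structure InterpolationCouple (A B V : Type*) [NormedAddCommGroup A] [NormedSpace ℂ A]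
    [NormedAddCommGroup B] [NormedSpace ℂ B] [AddCommGroup V] [Module ℂ V]
    [TopologicalSpace V] where
  left : A →L[ℂ] V
  right : B →L[ℂ] V
  left_injective : Function.Injective left
  right_injective : Function.Injective right

namespace InterpolationCouple

set_option linter.unusedSectionVars false

section

variable {A B V : Type*} [NormedAddCommGroup A] [NormedSpace ℂ A]
  [NormedAddCommGroup B] [NormedSpace ℂ B] [AddCommGroup V] [Module ℂ V]
  [TopologicalSpace V] [IsTopologicalAddGroup V] [ContinuousSMul ℂ V] [T2Space V]

/-- The addition map `(a, b) ↦ a + b` into the ambient space. -/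
def addMap (c : InterpolationCouple A B V) : WithLp 1 (A × B) →L[ℂ] V :=
  (c.left.coprod c.right).comp
    (WithLp.prodContinuousLinearEquiv 1 ℂ A B : WithLp 1 (A × B) →L[ℂ] A × B)

/-- The pairs `(a, b)` with `a + b = 0` in the ambient space. -/
def kernel (c : InterpolationCouple A B V) : Submodule ℂ (WithLp 1 (A × B)) :=
  LinearMap.ker (c.addMap : WithLp 1 (A × B) →ₗ[ℂ] V)

instance isClosed_kernel (c : InterpolationCouple A B V) :
    IsClosed (c.kernel : Set (WithLp 1 (A × B))) :=
  isClosed_singleton.preimage c.addMap.continuous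

/-- The sum `A + B`, with norm `‖x‖ = inf {‖a‖ + ‖b‖ : x = a + b}`, as a quotient of the
`ℓ¹`-product of `A` and `B`. -/
abbrev Sum (c : InterpolationCouple A B V) : Type _ := WithLp 1 (A × B) ⧸ c.kernel

/-- The inclusion of `A` into `A + B`. -/
def inl (c : InterpolationCouple A B V) (a : A) : c.Sum :=
  Submodule.Quotient.mk (WithLp.toLp 1 (a, 0))

/-- The inclusion of `B` into `A + B`. -/
def inr (c : InterpolationCouple A B V) (b : B) : c.Sum :=
  Submodule.Quotient.mk (WithLp.toLp 1 (0, b))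

theorem inl_add (c : InterpolationCouple A B V) (a a' : A) :
    c.inl (a + a') = c.inl a + c.inl a' := by
  rw [inl, inl, inl, ← Submodule.Quotient.mk_add, ← WithLp.toLp_add, Prod.mk_add_mk, add_zero]

theorem inl_smul (c : InterpolationCouple A B V) (k : ℂ) (a : A) :
    c.inl (k • a) = k • c.inl a := by
  rw [inl, inl, ← Submodule.Quotient.mk_smul, ← WithLp.toLp_smul, Prod.smul_mk, smul_zero]

theorem inr_add (c : InterpolationCouple A B V) (b b' : B) :
    c.inr (b + b') = c.inr b + c.inr b' := by
  rw [inr, inr, inr, ← Submodule.Quotient.mk_add, ← WithLp.toLp_add, Prod.mk_add_mk, add_zero]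

theorem inr_smul (c : InterpolationCouple A B V) (k : ℂ) (b : B) :
    c.inr (k • b) = k • c.inr b := by
  rw [inr, inr, ← Submodule.Quotient.mk_smul, ← WithLp.toLp_smul, Prod.smul_mk, smul_zero]

/-- The functions used in complex interpolation: bounded and continuous on the closed strip
`0 ≤ Re z ≤ 1` with values in `A + B`, holomorphic inside, and bounded and continuous with
values in `A` on `Re z = 0` and with values in `B` on `Re z = 1`. -/
structure Admissible (c : InterpolationCouple A B V) where
  toFun : ℂ → c.Sum
  diffContOnCl : DiffContOnCl ℂ toFun (Complex.HadamardThreeLines.verticalStrip 0 1)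
  bounded : ∃ M : ℝ, ∀ z ∈ Complex.HadamardThreeLines.verticalClosedStrip 0 1, ‖toFun z‖ ≤ M
  onLeft : ℝ →ᵇ A
  onRight : ℝ →ᵇ B
  onLeft_eq : ∀ t : ℝ, toFun (t * Complex.I) = c.inl (onLeft t)
  onRight_eq : ∀ t : ℝ, toFun (1 + t * Complex.I) = c.inr (onRight t)

/-- The complex interpolation space `[A, B]_θ` as a subspace of `A + B`. -/
def interp (c : InterpolationCouple A B V) (θ : ℝ) : Submodule ℂ c.Sum where
  carrier := {x | ∃ F : c.Admissible, F.toFun θ = x}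
  zero_mem' := ⟨{
    toFun := fun _ => 0
    diffContOnCl := diffContOnCl_const
    bounded := ⟨0, fun z _ => by simp⟩
    onLeft := 0
    onRight := 0
    onLeft_eq := fun t => by
      have h := c.inl_smul 0 0
      simp only [zero_smul] at h
      simp [h]
    onRight_eq := fun t => by
      have h := c.inr_smul 0 0
      simp only [zero_smul] at h
      simp [h] }, rfl⟩
  add_mem' := by
    rintro _ _ ⟨F, rfl⟩ ⟨G, rfl⟩
    exact ⟨{
      toFun := fun z => F.toFun z + G.toFun z
      diffContOnCl := F.diffContOnCl.add G.diffContOnCl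
      bounded := by
        obtain ⟨M, hM⟩ := F.bounded
        obtain ⟨N, hN⟩ := G.bounded
        exact ⟨M + N, fun z hz => (norm_add_le _ _).trans (add_le_add (hM z hz) (hN z hz))⟩
      onLeft := F.onLeft + G.onLeft
      onRight := F.onRight + G.onRight
      onLeft_eq := fun t => by
        rw [F.onLeft_eq, G.onLeft_eq, BoundedContinuousFunction.add_apply, c.inl_add]
      onRight_eq := fun t => by
        rw [F.onRight_eq, G.onRight_eq, BoundedContinuousFunction.add_apply, c.inr_add] }, rfl⟩
  smul_mem' := by
    rintro k _ ⟨F, rfl⟩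
    exact ⟨{
      toFun := fun z => k • F.toFun z
      diffContOnCl := F.diffContOnCl.const_smul k
      bounded := by
        obtain ⟨M, hM⟩ := F.bounded
        refine ⟨‖k‖ * M, fun z hz => ?_⟩
        rw [norm_smul]
        exact mul_le_mul_of_nonneg_left (hM z hz) (norm_nonneg k)
      onLeft := k • F.onLeft
      onRight := k • F.onRight
      onLeft_eq := fun t => by
        rw [F.onLeft_eq, BoundedContinuousFunction.smul_apply, c.inl_smul]
      onRight_eq := fun t => by
        rw [F.onRight_eq, BoundedContinuousFunction.smul_apply, c.inr_smul] }, rfl⟩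

/-- The norm of `[A, B]_θ`: the infimum, over the admissible `F` with `F(θ) = x`, of
`max (sup_t ‖F(it)‖_A, sup_t ‖F(1+it)‖_B)`. -/
def interpNorm (c : InterpolationCouple A B V) (θ : ℝ) (x : c.Sum) : ℝ :=
  sInf {m | ∃ F : c.Admissible, F.toFun θ = x ∧ m = max ‖F.onLeft‖ ‖F.onRight‖}

end

end InterpolationCouple

/-- `X` is `r`-Hilbertian: it is isomorphic to `[H, Y]_θ` for an interpolation couple of a
Hilbert space `H` and a Banach space `Y`, where `1/r = (1-θ)/2 + θ/∞`. -/
def IsHilbertian (r : ℝ) (X : Type u) [NormedAddCommGroup X] [NormedSpace ℂ X] : Prop :=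
  ∃ (H : Type v) (_ : NormedAddCommGroup H) (_ : InnerProductSpace ℂ H) (_ : CompleteSpace H)
    (Y : Type v) (_ : NormedAddCommGroup Y) (_ : NormedSpace ℂ Y) (_ : CompleteSpace Y)
    (V : Type v) (_ : AddCommGroup V) (_ : Module ℂ V) (_ : TopologicalSpace V)
    (_ : IsTopologicalAddGroup V) (_ : ContinuousSMul ℂ V) (_ : T2Space V)
    (c : InterpolationCouple H Y V) (θ : ℝ),
    θ ∈ Icc (0 : ℝ) 1 ∧ 1 / r = (1 - θ) / 2 ∧
    ∃ (e : X ≃ₗ[ℂ] c.interp θ) (k K : ℝ), 0 < k ∧ 0 < K ∧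
      ∀ x : X, k * ‖x‖ ≤ c.interpNorm θ (e x : c.Sum) ∧
        c.interpNorm θ (e x : c.Sum) ≤ K * ‖x‖

end

noncomputable section

/-! ### Complex interpolation: admissible functions and the endpoint `θ = 0` -/

namespace InterpolationCouple

open Complex.HadamardThreeLines

section Basic

set_option linter.unusedSectionVars false

variable {A B V : Type*} [NormedAddCommGroup A] [NormedSpace ℂ A]
  [NormedAddCommGroup B] [NormedSpace ℂ B] [AddCommGroup V] [Module ℂ V]
  [TopologicalSpace V] [IsTopologicalAddGroup V] [ContinuousSMul ℂ V] [T2Space V]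
  {c : InterpolationCouple A B V}

/-! Two endpoints carry the theorem: the bound at `∞`, which holds because every wave packet has
`L¹` norm `1`, and the weak type bound at `r`. The exponents in between follow by Marcinkiewicz
interpolation.

For the weak type bound, fix a height `t > 0`. A tritile `P` with `‖E[f](P)‖ > t` satisfies `t |I_P|
≤ ‖f‖₁`, so the scales of these tritiles are bounded above and each of them lies below a maximal
one. Tritiles that overlap as rectangles are comparable; hence the maximal ones are pairwise
disjoint, and their trees cover the level set. Choose in each a tile whose coefficient exceeds `t`.
These tiles are pairwise disjoint, so it remains to show that `X` has tile type `r`: `∑ |I_P| ‖⟨f;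
w_P⟩‖^r ≤ D ‖f‖_r^r` over finite sets of pairwise disjoint tiles (`IsHilbertian.exists_tile_bound`).

On a Hilbert space with `r = 2` this is Bessel's inequality, because disjoint tiles have orthogonal
wave packets. On any Banach space the `ℓ^∞` analogue is trivial. Tile type `r` interpolates the two.
A Schwartz function takes finitely many values, so its coefficients are the image of these values
under the finite matrix `C P x = ∫_{f = x} w_P`, and the problem becomes one about matrices that are
bounded on weighted `ℓ²` and have rows bounded in `ℓ¹` (`IsHilbertian.exists_matrix_bound`).

To interpolate, extend each value `x` to an admissible `F_x` with `F_x(θ) = x` and with norm at most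
a constant times `‖x‖` on both boundary lines, multiply it by a scalar factor that adjusts the
powers of `‖x‖`, and apply the matrix to get one admissible function `G_P` per tile. The norm of
`G_P(θ)` is defined through suprema over the boundary lines, whereas the `ℓ²` bound controls a sum
over `P` at one height of the line `Re z = 0`. Calderón's inequality resolves this, as it bounds the
norm by an average over that line (`interpNorm_le_grid`). An arithmetic mean is enough, so no outer
function is needed: one divides by a holomorphic function whose real part is a Riemann sum of a
Poisson integral and dominates the boundary norm. If `θ = 0`, then `r = 2` and `X` embeds in `H`, so
Bessel's inequality suffices once `[H, Y]_0` is known to carry the norm of `H`. -/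

theorem inl_injective : Function.Injective c.inl := by
  intro a a' h
  rw [inl, inl, Submodule.Quotient.eq, kernel, LinearMap.mem_ker] at h
  apply c.left_injective
  have h2 : c.left (a - a') + c.right (0 - 0) = 0 := h
  rw [sub_zero, map_zero, add_zero, map_sub, sub_eq_zero] at h2
  exact h2

theorem inl_sum {ι : Type*} (s : Finset ι) (k : ι → ℂ) (a : ι → A) :
    c.inl (∑ i ∈ s, k i • a i) = ∑ i ∈ s, k i • c.inl (a i) := by
  let L : A →ₗ[ℂ] c.Sum := ⟨⟨c.inl, c.inl_add⟩, c.inl_smul⟩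
  have : L (∑ i ∈ s, k i • a i) = ∑ i ∈ s, k i • L (a i) := by
    simp only [map_sum, map_smul]
  exact this

theorem inr_sum {ι : Type*} (s : Finset ι) (k : ι → ℂ) (b : ι → B) :
    c.inr (∑ i ∈ s, k i • b i) = ∑ i ∈ s, k i • c.inr (b i) := by
  let L : B →ₗ[ℂ] c.Sum := ⟨⟨c.inr, c.inr_add⟩, c.inr_smul⟩
  have : L (∑ i ∈ s, k i • b i) = ∑ i ∈ s, k i • L (b i) := by
    simp only [map_sum, map_smul]
  exact this

theorem closure_verticalStrip_subset :
    closure (verticalStrip 0 1) ⊆ verticalClosedStrip 0 1 :=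
  closure_minimal (preimage_mono Ioo_subset_Icc_self) (isClosed_Icc.preimage Complex.continuous_re)

/-- A linear combination of admissible functions whose coefficients are bounded holomorphic
functions. -/
def Admissible.combination {ι : Type*} (s : Finset ι) (φ : ι → ℂ → ℂ) (F : ι → c.Admissible)
    (hd : ∀ i, ∀ z : ℂ, 0 ≤ z.re → DifferentiableAt ℂ (φ i) z)
    (hb : ∀ i, ∃ M : ℝ, ∀ z ∈ verticalClosedStrip 0 1, ‖φ i z‖ ≤ M) : c.Admissible where
  toFun z := ∑ i ∈ s, φ i z • (F i).toFun z
  diffContOnCl := by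
    have h1 : ∀ i, DiffContOnCl ℂ (φ i) (verticalStrip 0 1) := fun i =>
      DifferentiableOn.diffContOnCl fun z hz =>
        (hd i z (closure_verticalStrip_subset hz).1).differentiableWithinAt
    classical
    induction s using Finset.induction_on with
    | empty => simpa using diffContOnCl_const
    | insert i s hi ih =>
      simp only [Finset.sum_insert hi]
      exact ((h1 i).smul (F i).diffContOnCl).add ih
  bounded := by
    choose M hM using hb
    choose N hN using fun i => (F i).bounded
    refine ⟨∑ i ∈ s, M i * N i, fun z hz => (norm_sum_le _ _).trans (Finset.sum_le_sum ?_)⟩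
    intro i _
    rw [norm_smul]
    exact mul_le_mul (hM i z hz) (hN i z hz) (norm_nonneg _) ((norm_nonneg _).trans (hM i z hz))
  onLeft := BoundedContinuousFunction.ofNormedAddCommGroup
    (fun t => ∑ i ∈ s, φ i (t * Complex.I) • (F i).onLeft t)
    (by
      refine continuous_finsetSum _ fun i _ => Continuous.smul ?_ (F i).onLeft.continuous
      refine continuous_iff_continuousAt.mpr fun t => ?_
      exact (hd i _ (by simp)).continuousAt.comp (f := fun t : ℝ => (t * Complex.I : ℂ))
        (by fun_prop))
    (∑ i ∈ s, (hb i).choose * ‖(F i).onLeft‖)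
    (fun t => (norm_sum_le _ _).trans (Finset.sum_le_sum fun i _ => by
      have hz : (t * Complex.I : ℂ) ∈ verticalClosedStrip 0 1 := by simp [verticalClosedStrip]
      have h := (hb i).choose_spec _ hz
      rw [norm_smul]
      exact mul_le_mul h ((F i).onLeft.norm_coe_le_norm t) (norm_nonneg _)
        ((norm_nonneg _).trans h)))
  onRight := BoundedContinuousFunction.ofNormedAddCommGroup
    (fun t => ∑ i ∈ s, φ i (1 + t * Complex.I) • (F i).onRight t)
    (by
      refine continuous_finsetSum _ fun i _ => Continuous.smul ?_ (F i).onRight.continuous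
      refine continuous_iff_continuousAt.mpr fun t => ?_
      exact (hd i _ (by simp)).continuousAt.comp (f := fun t : ℝ => (1 + t * Complex.I : ℂ))
        (by fun_prop))
    (∑ i ∈ s, (hb i).choose * ‖(F i).onRight‖)
    (fun t => (norm_sum_le _ _).trans (Finset.sum_le_sum fun i _ => by
      have hz : (1 + t * Complex.I : ℂ) ∈ verticalClosedStrip 0 1 := by simp [verticalClosedStrip]
      have h := (hb i).choose_spec _ hz
      rw [norm_smul]
      exact mul_le_mul h ((F i).onRight.norm_coe_le_norm t) (norm_nonneg _)
        ((norm_nonneg _).trans h)))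
  onLeft_eq t := by
    simp only [(F _).onLeft_eq]
    exact (inl_sum s _ _).symm
  onRight_eq t := by
    simp only [(F _).onRight_eq]
    exact (inr_sum s _ _).symm

theorem interpNorm_le {θ : ℝ} (F : c.Admissible) {C : ℝ} (hC : 0 ≤ C)
    (hl : ∀ t, ‖F.onLeft t‖ ≤ C) (hr : ∀ t, ‖F.onRight t‖ ≤ C) :
    c.interpNorm θ (F.toFun θ) ≤ C := by
  refine csInf_le_of_le ⟨0, ?_⟩ ⟨F, rfl, rfl⟩ (max_le ?_ ?_)
  · rintro _ ⟨G, -, rfl⟩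
    exact le_max_of_le_left (norm_nonneg _)
  · exact (BoundedContinuousFunction.norm_le hC).mpr hl
  · exact (BoundedContinuousFunction.norm_le hC).mpr hr

theorem exists_admissible {θ : ℝ} {x : c.Sum} (hx : x ∈ c.interp θ) {C : ℝ}
    (hC : c.interpNorm θ x < C) :
    ∃ F : c.Admissible, F.toFun θ = x ∧ (∀ t, ‖F.onLeft t‖ ≤ C) ∧ ∀ t, ‖F.onRight t‖ ≤ C := by
  obtain ⟨G, hG⟩ := hx
  have hne : Set.Nonempty {m | ∃ F : c.Admissible, F.toFun θ = x ∧
      m = max ‖F.onLeft‖ ‖F.onRight‖} := ⟨_, G, hG, rfl⟩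
  obtain ⟨_, ⟨F, hF, rfl⟩, hlt⟩ := exists_lt_of_csInf_lt hne hC
  rw [max_lt_iff] at hlt
  exact ⟨F, hF, fun t => (F.onLeft.norm_coe_le_norm t).trans hlt.1.le,
    fun t => (F.onRight.norm_coe_le_norm t).trans hlt.2.le⟩

/-- The point `0` lies on the boundary of the strip, so `F(0)` is the left boundary value of `F` at
height `0`. -/
theorem norm_le_interpNorm_zero {a : A} (ha : c.inl a ∈ c.interp 0) :
    ‖a‖ ≤ c.interpNorm 0 (c.inl a) := by
  obtain ⟨G, hG⟩ := ha
  refine le_csInf ⟨_, G, hG, rfl⟩ ?_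
  rintro _ ⟨F, hF, rfl⟩
  have h := F.onLeft_eq 0
  rw [Complex.ofReal_zero] at hF
  rw [Complex.ofReal_zero, zero_mul, hF] at h
  rw [inl_injective h]
  exact le_max_of_le_left (F.onLeft.norm_coe_le_norm 0)

theorem exists_inl_of_mem_interp_zero {x : c.Sum} (hx : x ∈ c.interp 0) : ∃ a, c.inl a = x := by
  obtain ⟨G, hG⟩ := hx
  refine ⟨G.onLeft 0, ?_⟩
  rw [← G.onLeft_eq 0, ← hG, Complex.ofReal_zero, zero_mul]

/-- An admissible `F` with `F(0) = a` may be large away from `0`. The multiplier `exp(-nz) / (1 +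
mz)` is `1` at `0` and bounded by `1`. Its denominator damps the line `Re z = 0` away from `0`, its
exponential damps the line `Re z = 1`, and near `0` continuity gives `‖a‖ + ε`. -/
theorem interpNorm_zero_le_norm {a : A} (ha : c.inl a ∈ c.interp 0) :
    c.interpNorm 0 (c.inl a) ≤ ‖a‖ := by
  obtain ⟨F, hF⟩ := ha
  have h0 : F.onLeft 0 = a := by
    apply inl_injective (c := c)
    rw [← F.onLeft_eq 0, ← hF, Complex.ofReal_zero, zero_mul]
  refine le_of_forall_pos_le_add fun ε hε => ?_
  obtain ⟨δ, hδ, hcont⟩ := Metric.continuousAt_iff.mp (F.onLeft.continuous.continuousAt (x := 0)) ε hε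
  set L := max ‖F.onLeft‖ ‖F.onRight‖ with hL
  have hL0 : 0 ≤ L := le_max_of_le_left (norm_nonneg _)
  -- Chosen so that `m δ = L / ε`, which gives `|1 + imt| ≥ L / ε` for `|t| ≥ δ`; below, `n = L / ε`
  -- gives `exp(-n) L ≤ ε`.
  obtain ⟨m, hm⟩ : ∃ m : ℝ, m = L / (δ * ε) := ⟨_, rfl⟩
  have hm0 : 0 ≤ m := by rw [hm]; positivity
  obtain ⟨n, hn⟩ : ∃ n : ℝ, n = L / ε := ⟨_, rfl⟩
  have hn0 : 0 ≤ n := by rw [hn]; positivity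
  let φ : ℂ → ℂ := fun z => Complex.exp (-(n * z)) / (1 + m * z)
  have hden : ∀ z : ℂ, 0 ≤ z.re → 1 ≤ ‖(1 + m * z : ℂ)‖ := fun z hz => by
    refine le_trans ?_ (Complex.re_le_norm _)
    simp only [Complex.add_re, Complex.one_re, Complex.re_ofReal_mul]
    nlinarith [mul_nonneg hm0 hz]
  have hden0 : ∀ z : ℂ, 0 ≤ z.re → (1 + m * z : ℂ) ≠ 0 := fun z hz h => by
    have := hden z hz
    rw [h, norm_zero] at this
    linarith
  have hφ : ∀ z : ℂ, ‖φ z‖ = Real.exp (-(n * z.re)) / ‖(1 + m * z : ℂ)‖ := fun z => by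
    simp only [φ, norm_div, Complex.norm_exp, Complex.neg_re, Complex.re_ofReal_mul]
  have hφ1 : ∀ z : ℂ, 0 ≤ z.re → ‖φ z‖ ≤ 1 := fun z hz => by
    rw [hφ]
    refine (div_le_one (lt_of_lt_of_le one_pos (hden z hz))).mpr (le_trans ?_ (hden z hz))
    rw [Real.exp_le_one_iff]
    nlinarith [mul_nonneg hn0 hz]
  let G : c.Admissible := Admissible.combination (Finset.univ : Finset Unit) (fun _ => φ)
    (fun _ => F)
    (fun _ z hz => by
      have := hden0 z hz
      fun_prop (disch := assumption))
    (fun _ => ⟨1, fun z hz => hφ1 z hz.1⟩)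
  have hGL : ∀ t, G.onLeft t = φ (t * Complex.I) • F.onLeft t := fun t =>
    Fintype.sum_unique (fun _ : Unit => φ (t * Complex.I) • F.onLeft t)
  have hGR : ∀ t, G.onRight t = φ (1 + t * Complex.I) • F.onRight t := fun t =>
    Fintype.sum_unique (fun _ : Unit => φ (1 + t * Complex.I) • F.onRight t)
  have hG0 : G.toFun (0 : ℝ) = c.inl a := by
    have : G.toFun (0 : ℝ) = φ (0 : ℝ) • F.toFun (0 : ℝ) :=
      Fintype.sum_unique (fun _ : Unit => φ (0 : ℝ) • F.toFun (0 : ℝ))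
    rw [this, hF]
    simp [φ]
  have key := interpNorm_le (θ := 0) G (C := ‖a‖ + ε) (by positivity) ?_ ?_
  · rwa [hG0] at key
  · intro t
    rw [hGL, norm_smul]
    by_cases ht : |t| < δ
    · have h1 := hcont (x := t) (by simpa using ht)
      rw [h0, dist_eq_norm] at h1
      have h2 : ‖F.onLeft t‖ ≤ ‖a‖ + ε := by
        have := norm_le_norm_add_norm_sub' (F.onLeft t) a
        linarith
      calc _ ≤ 1 * ‖F.onLeft t‖ :=
            mul_le_mul_of_nonneg_right (hφ1 _ (by simp)) (norm_nonneg _)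
        _ ≤ _ := by rw [one_mul]; exact h2
    · push Not at ht
      have h1 : m * δ ≤ ‖(1 + m * (t * Complex.I) : ℂ)‖ := by
        refine le_trans ?_ (Complex.abs_im_le_norm _)
        have : (1 + m * (t * Complex.I) : ℂ).im = m * t := by simp
        rw [this, abs_mul, abs_of_nonneg hm0]
        exact mul_le_mul_of_nonneg_left ht hm0
      have h2 : L ≤ ε * ‖(1 + m * (t * Complex.I) : ℂ)‖ := by
        have : m * δ = L / ε := by rw [hm]; field_simp
        rw [this] at h1
        rw [div_le_iff₀ hε] at h1
        linarith
      have h3 : ‖φ (t * Complex.I)‖ * ‖F.onLeft t‖ ≤ ε := by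
        rw [hφ]
        have h4 : Real.exp (-(n * (t * Complex.I : ℂ).re)) = 1 := by simp
        rw [h4, one_div, inv_mul_le_iff₀ (lt_of_lt_of_le one_pos (hden _ (by simp)))]
        rw [mul_comm]
        exact ((F.onLeft.norm_coe_le_norm t).trans (le_max_left _ _)).trans h2
      linarith [norm_nonneg a]
  · intro t
    rw [hGR, norm_smul, hφ]
    have h1 : (1 + t * Complex.I : ℂ).re = 1 := by simp
    have h2 := hden (1 + t * Complex.I) (by rw [h1]; norm_num)
    have h3 : Real.exp (-(n * (1 + t * Complex.I : ℂ).re)) / ‖(1 + m * (1 + t * Complex.I) : ℂ)‖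
        ≤ Real.exp (-n) := by
      rw [h1, mul_one]
      exact div_le_self (Real.exp_pos _).le h2
    have h4 : Real.exp (-n) * L ≤ ε := by
      have h5 : L ≤ ε * Real.exp n := by
        have h6 := Real.add_one_le_exp n
        have h7 : L = ε * n := by rw [hn]; field_simp
        nlinarith
      rw [Real.exp_neg, inv_mul_le_iff₀ (Real.exp_pos _)]
      linarith
    have h5 : ‖F.onRight t‖ ≤ L := (F.onRight.norm_coe_le_norm t).trans (le_max_right _ _)
    calc _ ≤ Real.exp (-n) * L := mul_le_mul h3 h5 (norm_nonneg _) (Real.exp_pos _).le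
      _ ≤ _ := by linarith [norm_nonneg a]

end Basic

end InterpolationCouple

/-! ### Grids on the line and a discrete Poisson integral -/

/-- A Riemann sum of `∫ dx / (1 + x²)`, bounded independently of the mesh and of the cut-off. -/
theorem sum_grid_le {n : ℕ} (hn : 0 < n) (M : ℕ) :
    ∑ j ∈ Finset.Icc (-(M : ℤ)) M, (n : ℝ)⁻¹ / (1 + (j * (n : ℝ)⁻¹) ^ 2) ≤ (8 : ℝ) := by
  have hn' : (1 : ℝ) ≤ n := by exact_mod_cast hn
  -- The subtracted term makes the induction telescope: for `x = M + 1` the two new terms are each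
  -- at most `4n / ((n + x)(n + x + 1))`, and together these majorants are exactly its decrease.
  suffices h : ∑ j ∈ Finset.Icc (-(M : ℤ)) M, (n : ℝ)⁻¹ / (1 + (j * (n : ℝ)⁻¹) ^ 2)
      ≤ (8 : ℝ) - 8 * n / (n + M + 1) from h.trans (sub_le_self _ (by positivity))
  induction M with
  | zero =>
    simp only [Nat.cast_zero, neg_zero, Finset.Icc_self, Finset.sum_singleton, Int.cast_zero,
      zero_mul, add_zero]
    have h1 : (n : ℝ)⁻¹ ≤ 1 := inv_le_one_of_one_le₀ hn'
    have h2 : 8 - 8 * (n : ℝ) / (n + 1) = 8 / (n + 1) := by field_simp; ring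
    rw [h2, le_div_iff₀ (by positivity)]
    have h3 : (n : ℝ)⁻¹ * n = 1 := inv_mul_cancel₀ (by positivity)
    simp only [ne_eq, OfNat.ofNat_ne_zero, not_false_eq_true, zero_pow, add_zero, div_one]
    nlinarith
  | succ M ih =>
    have hI : Finset.Icc (-((M + 1 : ℕ) : ℤ)) ((M + 1 : ℕ) : ℤ)
        = insert ((M + 1 : ℕ) : ℤ) (insert (-((M + 1 : ℕ) : ℤ)) (Finset.Icc (-(M : ℤ)) M)) := by
      ext j
      simp only [Finset.mem_insert, Finset.mem_Icc]
      omega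
    rw [hI, Finset.sum_insert (by simp; omega), Finset.sum_insert (by simp)]
    set x : ℝ := ((M + 1 : ℕ) : ℝ) with hx
    have hx0 : 1 ≤ x := by rw [hx]; push_cast; linarith [Nat.cast_nonneg (α := ℝ) M]
    have hM : (M : ℝ) = x - 1 := by rw [hx]; push_cast; ring
    have e1 : (((M + 1 : ℕ) : ℤ) : ℝ) = x := by push_cast [hx]; ring
    have e2 : ((-((M + 1 : ℕ) : ℤ) : ℤ) : ℝ) = -x := by push_cast [hx]; ring
    rw [e1, e2]
    rw [hM] at ih
    have h1 : (n : ℝ)⁻¹ / (1 + (x * (n : ℝ)⁻¹) ^ 2) ≤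
        4 * n / ((n + x) * (n + x + 1)) := by
      have h2 : (n : ℝ)⁻¹ / (1 + (x * (n : ℝ)⁻¹) ^ 2) = n / (n ^ 2 + x ^ 2) := by
        field_simp
      rw [h2, div_le_div_iff₀ (by positivity) (by positivity)]
      have h4 : (n + x) * (n + x + 1) ≤ 4 * ((n : ℝ) ^ 2 + x ^ 2) := by
        nlinarith [sq_nonneg ((n : ℝ) - x)]
      nlinarith
    have h3 : (n : ℝ)⁻¹ / (1 + (-x * (n : ℝ)⁻¹) ^ 2) = (n : ℝ)⁻¹ / (1 + (x * (n : ℝ)⁻¹) ^ 2) := by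
      rw [neg_mul, neg_sq]
    have h5 : 8 * (n : ℝ) / (n + (x - 1) + 1) - 8 * n / (n + x + 1)
        = 2 * (4 * n / ((n + x) * (n + x + 1))) := by
      have : (n : ℝ) + (x - 1) + 1 = n + x := by ring
      rw [this]
      field_simp
      ring
    rw [h3]
    linarith

theorem div_one_add_sq_le {D ε x : ℝ} (hε : 0 < ε) (hx : D / ε + 1 ≤ |x|) :
    D / (1 + x ^ 2) ≤ ε := by
  rw [div_le_iff₀ (by positivity), ← sq_abs x]
  have h2 : D = ε * (D / ε) := by field_simp
  have h3 : D / ε ≤ 1 + |x| ^ 2 := by nlinarith [sq_nonneg (|x| - 1)]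
  calc D = ε * (D / ε) := h2
    _ ≤ _ := mul_le_mul_of_nonneg_left h3 hε.le

/-- Quadratic decay makes each continuous `u P` uniformly continuous, and finiteness of `t` gives a
common mesh and cut-off. It is applied to `u P y = ‖G_P(iy)‖`. -/
theorem exists_grid {τ : Type*} (t : Finset τ) (u : τ → ℝ → ℝ) (D : τ → ℝ)
    (hc : ∀ P, Continuous (u P)) (h0 : ∀ P x, 0 ≤ u P x)
    (hD : ∀ P x, u P x ≤ D P / (1 + x ^ 2)) {ε : ℝ} (hε : 0 < ε) :
    ∃ n : ℕ, 0 < n ∧ ∃ M : ℕ, ∀ P ∈ t,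
      (∀ x y, |x - y| ≤ (n : ℝ)⁻¹ → u P x ≤ u P y + ε) ∧
      ∀ x, M * (n : ℝ)⁻¹ ≤ |x| → u P x ≤ ε := by
  have htail : ∀ P x, D P / ε + 1 ≤ |x| → u P x ≤ ε := by
    intro P x hx
    exact (hD P x).trans (div_one_add_sq_le hε hx)
  have huc : ∀ P, UniformContinuous (u P) := fun P => by
    refine (hc P).uniformContinuous_of_tendsto_cocompact (x := 0) ?_
    rw [← Metric.cobounded_eq_cocompact, Metric.tendsto_nhds]
    intro δ hδ
    have h1 : Filter.Tendsto (fun x : ℝ => ‖x‖) (Bornology.cobounded ℝ) Filter.atTop :=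
      tendsto_norm_cobounded_atTop
    filter_upwards [h1.eventually_ge_atTop (D P / (δ / 2) + 1)] with x hx
    have h2 : D P / (1 + x ^ 2) ≤ δ / 2 := div_one_add_sq_le (half_pos hδ) hx
    rw [Real.dist_eq, sub_zero, abs_of_nonneg (h0 P x)]
    linarith [hD P x]
  have hosc : ∀ P ∈ t, ∀ᶠ n : ℕ in Filter.atTop,
      ∀ x y, |x - y| ≤ (n : ℝ)⁻¹ → u P x ≤ u P y + ε := by
    intro P _
    obtain ⟨δ, hδ, h⟩ := Metric.uniformContinuous_iff.mp (huc P) ε hε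
    have h1 := (tendsto_inv_atTop_nhds_zero_nat (𝕜 := ℝ)).eventually_lt_const hδ
    filter_upwards [h1] with n hn x y hxy
    have h2 := h (a := x) (b := y) (by rw [Real.dist_eq]; linarith)
    rw [Real.dist_eq] at h2
    linarith [le_abs_self (u P x - u P y)]
  obtain ⟨n, hn, hn0⟩ := (((Filter.eventually_all_finset t).mpr hosc).and
    (Filter.eventually_gt_atTop 0)).exists
  have hn1 : (0 : ℝ) < n := by exact_mod_cast hn0
  have hM : ∀ P ∈ t, ∀ᶠ M : ℕ in Filter.atTop, (D P / ε + 1) * n ≤ M := fun P _ =>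
    tendsto_natCast_atTop_atTop.eventually_ge_atTop _
  obtain ⟨M, hM⟩ := ((Filter.eventually_all_finset t).mpr hM).exists
  refine ⟨n, hn0, M, fun P hP => ⟨hn P hP, fun x hx => htail P x (le_trans ?_ hx)⟩⟩
  rw [← div_eq_mul_inv, le_div_iff₀ hn1]
  exact hM P hP

/-- A discretised Poisson integral of `u` over the line `Re z = 0`, completed to a holomorphic
function on the right half plane. -/
def gridPoisson (h : ℝ) (M : ℕ) (u : ℤ → ℝ) (z : ℂ) : ℂ :=
  ∑ j ∈ Finset.Icc (-(M : ℤ)) M, ((h * u j : ℝ) : ℂ) / (z + h - (j * h : ℝ) * Complex.I)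

section gridPoisson

variable {h : ℝ} {M : ℕ} {u : ℤ → ℝ} {z : ℂ}

theorem gridPoisson_denom_re (j : ℤ) : (z + h - (j * h : ℝ) * Complex.I).re = z.re + h := by simp

theorem gridPoisson_denom_im (j : ℤ) : (z + h - (j * h : ℝ) * Complex.I).im = z.im - j * h := by
  simp

/-- The poles sit at `-h + ijh`: the shift by one mesh width keeps them off the closed half plane.
-/
theorem gridPoisson_denom_ne_zero (hh : 0 < h) (hz : 0 ≤ z.re) (j : ℤ) :
    z + h - (j * h : ℝ) * Complex.I ≠ 0 := fun h0 => by
  have := gridPoisson_denom_re (h := h) (z := z) j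
  rw [h0, Complex.zero_re] at this
  linarith

theorem differentiableAt_gridPoisson (hh : 0 < h) (hz : 0 ≤ z.re) :
    DifferentiableAt ℂ (gridPoisson h M u) z := by
  unfold gridPoisson
  refine DifferentiableAt.fun_sum fun j _ => ?_
  have := gridPoisson_denom_ne_zero hh hz j
  fun_prop (disch := assumption)

theorem re_gridPoisson_term (j : ℤ) (z : ℂ) :
    (((h * u j : ℝ) : ℂ) / (z + h - (j * h : ℝ) * Complex.I)).re
      = h * u j * (z.re + h) / ((z.re + h) ^ 2 + (z.im - j * h) ^ 2) := by
  rw [Complex.div_re, gridPoisson_denom_re, Complex.normSq_apply, gridPoisson_denom_re,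
    gridPoisson_denom_im, Complex.ofReal_re, Complex.ofReal_im, zero_mul, zero_div, add_zero,
    ← sq, ← sq]

theorem re_gridPoisson_nonneg (hh : 0 < h) (hu : ∀ j, 0 ≤ u j) (hz : 0 ≤ z.re) :
    0 ≤ (gridPoisson h M u z).re := by
  rw [gridPoisson, Complex.re_sum]
  refine Finset.sum_nonneg fun j _ => ?_
  rw [re_gridPoisson_term]
  have := hu j
  positivity

/-- All terms have nonnegative real part, and the `j`-th one is `u j · h² / (h² + (t - jh)²)`, at
least `u j / 2`. -/
theorem le_re_gridPoisson (hh : 0 < h) (hu : ∀ j, 0 ≤ u j) {t : ℝ} {j : ℤ}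
    (hj : j ∈ Finset.Icc (-(M : ℤ)) M) (ht : |t - j * h| ≤ h) :
    u j ≤ 2 * (gridPoisson h M u (t * Complex.I)).re := by
  rw [gridPoisson, Complex.re_sum]
  have h1 := Finset.single_le_sum (f := fun j : ℤ => (((h * u j : ℝ) : ℂ) /
    (t * Complex.I + h - (j * h : ℝ) * Complex.I)).re) (fun i _ => ?_) hj
  · refine le_trans ?_ (mul_le_mul_of_nonneg_left h1 zero_le_two)
    simp only [re_gridPoisson_term]
    have e1 : (t * Complex.I : ℂ).re = 0 := by simp
    have e2 : (t * Complex.I : ℂ).im = t := by simp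
    rw [e1, e2, zero_add, ← mul_div_assoc, le_div_iff₀ (by positivity)]
    have h2 : (t - j * h) ^ 2 ≤ h ^ 2 := sq_le_sq.mpr (by rwa [abs_of_pos hh])
    nlinarith [hu j]
  · simp only [re_gridPoisson_term]
    have e1 : (t * Complex.I : ℂ).re = 0 := by simp
    have := hu i
    rw [e1]
    positivity

/-- The loss of `1 / θ` is why the endpoint `θ = 0` is treated separately. -/
theorem norm_gridPoisson_le (hh : 0 < h) (hu : ∀ j, 0 ≤ u j) {θ : ℝ} (hθ : 0 < θ) :
    ‖gridPoisson h M u θ‖ ≤ (∑ j ∈ Finset.Icc (-(M : ℤ)) M, h * u j) / θ := by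
  rw [gridPoisson, Finset.sum_div]
  refine (norm_sum_le _ _).trans (Finset.sum_le_sum fun j _ => ?_)
  have h1 : θ ≤ ‖((θ : ℂ) + h - (j * h : ℝ) * Complex.I)‖ := by
    refine le_trans ?_ (Complex.re_le_norm _)
    rw [gridPoisson_denom_re, Complex.ofReal_re]
    linarith
  have h2 := hu j
  rw [norm_div, Complex.norm_real, Real.norm_of_nonneg (by positivity)]
  gcongr

end gridPoisson

/-! ### Calderón's inequality on a grid -/

namespace InterpolationCouple

open Complex.HadamardThreeLines

variable {A B V : Type*} [NormedAddCommGroup A] [NormedSpace ℂ A]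
  [NormedAddCommGroup B] [NormedSpace ℂ B] [AddCommGroup V] [Module ℂ V]
  [TopologicalSpace V] [IsTopologicalAddGroup V] [ContinuousSMul ℂ V] [T2Space V]
  {c : InterpolationCouple A B V}

/-- A discrete form of Calderón's inequality
`‖F θ‖_θ ≤ C (average of ‖F(it)‖) ^ (1 - θ) (sup ‖F(1 + it)‖) ^ θ`. -/
theorem interpNorm_le_grid {θ : ℝ} (hθ : 0 < θ) (F : c.Admissible) {R ε h : ℝ} (hR : 0 < R)
    (hε : 0 < ε) (hh : 0 < h) (M : ℕ) (hright : ∀ t, ‖F.onRight t‖ ≤ R)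
    (hosc : ∀ t s, |t - s| ≤ h → ‖F.onLeft t‖ ≤ ‖F.onLeft s‖ + ε)
    (htail : ∀ t, M * h ≤ |t| → ‖F.onLeft t‖ ≤ ε) {α : ℝ}
    (hα : α = 2 * ε + 2 / θ * ∑ j ∈ Finset.Icc (-(M : ℤ)) M, h * ‖F.onLeft (j * h)‖) :
    c.interpNorm θ (F.toFun θ) ≤ 2 * α ^ (1 - θ) * R ^ θ := by
  set u : ℤ → ℝ := fun j => ‖F.onLeft (j * h)‖ with hu_def
  have hu : ∀ j, 0 ≤ u j := fun j => norm_nonneg _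
  have hsum : 0 ≤ ∑ j ∈ Finset.Icc (-(M : ℤ)) M, h * u j :=
    Finset.sum_nonneg fun j _ => mul_nonneg hh.le (hu j)
  have hαε : 2 * ε ≤ α := by
    rw [hα]
    exact le_add_of_nonneg_right (by positivity)
  have hα0 : 0 < α := by linarith
  -- The substitute for an outer function: `|ψ| ≥ α` on the closed right half plane, `|ψ(it)| ≥
  -- ‖F(it)‖`, and `|ψ(θ)| ≤ 2α` by the choice of `α`.
  let ψ : ℂ → ℂ := fun z => α + 2 * gridPoisson h M u z
  have hre : ∀ z : ℂ, (ψ z).re = α + 2 * (gridPoisson h M u z).re := fun z => by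
    simp [ψ]
  have hψ : ∀ z : ℂ, 0 ≤ z.re → α ≤ ‖ψ z‖ := fun z hz => by
    refine le_trans ?_ (Complex.re_le_norm _)
    rw [hre]
    linarith [re_gridPoisson_nonneg (M := M) hh hu hz]
  have hψ0 : ∀ z : ℂ, 0 ≤ z.re → ψ z ≠ 0 := fun z hz h0 => by
    have := hψ z hz
    rw [h0, norm_zero] at this
    linarith
  have hψl : ∀ t : ℝ, ‖F.onLeft t‖ ≤ ‖ψ (t * Complex.I)‖ := fun t => by
    have h0 : 0 ≤ (t * Complex.I : ℂ).re := by simp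
    by_cases ht : M * h ≤ |t|
    · linarith [htail t ht, hψ _ h0]
    · push Not at ht
      have h1 : |t / h| < M := by rwa [abs_div, abs_of_pos hh, div_lt_iff₀ hh]
      rw [abs_lt] at h1
      have hj : ⌊t / h⌋ ∈ Finset.Icc (-(M : ℤ)) M := by
        rw [Finset.mem_Icc]
        constructor
        · rw [Int.le_floor]
          push_cast
          exact h1.1.le
        · have := (Int.floor_le (t / h)).trans h1.2.le
          exact_mod_cast this
      have h2 : |t - ⌊t / h⌋ * h| ≤ h := by
        have h3 : t - ⌊t / h⌋ * h = Int.fract (t / h) * h := by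
          rw [Int.fract, sub_mul, div_mul_cancel₀ _ hh.ne']
        rw [h3, abs_of_nonneg (mul_nonneg (Int.fract_nonneg _) hh.le)]
        nlinarith [Int.fract_lt_one (t / h)]
      have h4 := le_re_gridPoisson hh hu hj h2
      have h5 := hosc t _ h2
      refine le_trans ?_ (Complex.re_le_norm _)
      rw [hre]
      linarith
  have hψθ : ‖ψ θ‖ ≤ 2 * α := by
    refine (norm_add_le _ _).trans ?_
    rw [Complex.norm_real, Real.norm_of_nonneg hα0.le, norm_mul, Complex.norm_two]
    have h1 := norm_gridPoisson_le (M := M) hh hu hθ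
    have h2 : 2 * ((∑ j ∈ Finset.Icc (-(M : ℤ)) M, h * u j) / θ) = α - 2 * ε := by
      rw [hα]; ring
    linarith
  -- Here `φ(θ) = 1`. After the division by `ψ`, the function `F` is bounded by `2α` on the left
  -- line and by `2R` on the right; the factor `(α / R)^(z - θ)` turns both bounds into `2 α^(1 - θ)
  -- R^θ`.
  let φ : ℂ → ℂ := fun z => ψ θ / ψ z * Complex.exp (Real.log (α / R) * (z - θ))
  have hφ : ∀ z : ℂ, ‖φ z‖ = ‖ψ θ‖ / ‖ψ z‖ * Real.exp (Real.log (α / R) * (z.re - θ)) := fun z => by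
    simp only [φ, norm_mul, norm_div, Complex.norm_exp, Complex.re_ofReal_mul, Complex.sub_re,
      Complex.ofReal_re]
  have hq : ∀ z : ℂ, 0 ≤ z.re → ‖ψ θ‖ / ‖ψ z‖ ≤ 2 := fun z hz => by
    rw [div_le_iff₀ (hα0.trans_le (hψ z hz))]
    linarith [hψ z hz]
  let G : c.Admissible := Admissible.combination (Finset.univ : Finset Unit) (fun _ => φ)
    (fun _ => F)
    (fun _ z hz => by
      have h1 := hψ0 z hz
      have h2 : DifferentiableAt ℂ ψ z :=
        (differentiableAt_const _).add ((differentiableAt_gridPoisson hh hz).const_mul _)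
      fun_prop (disch := assumption))
    (fun _ => ⟨2 * Real.exp (|Real.log (α / R)| * (1 + |θ|)), fun z hz => by
      rw [hφ]
      refine mul_le_mul (hq z hz.1) (Real.exp_le_exp.mpr ((le_abs_self _).trans ?_))
        (Real.exp_pos _).le zero_le_two
      rw [abs_mul]
      refine mul_le_mul_of_nonneg_left ((abs_sub _ _).trans ?_) (abs_nonneg _)
      have : |z.re| ≤ 1 := by rw [abs_of_nonneg hz.1]; exact hz.2
      linarith⟩)
  have hGL : ∀ t, G.onLeft t = φ (t * Complex.I) • F.onLeft t := fun t =>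
    Fintype.sum_unique (fun _ : Unit => φ (t * Complex.I) • F.onLeft t)
  have hGR : ∀ t, G.onRight t = φ (1 + t * Complex.I) • F.onRight t := fun t =>
    Fintype.sum_unique (fun _ : Unit => φ (1 + t * Complex.I) • F.onRight t)
  have hGθ : G.toFun θ = F.toFun θ := by
    have h1 : G.toFun θ = φ θ • F.toFun θ :=
      Fintype.sum_unique (fun _ : Unit => φ θ • F.toFun θ)
    have h2 : φ θ = 1 := by
      simp only [φ, sub_self, mul_zero, Complex.exp_zero, mul_one]
      exact div_self (hψ0 _ (by simpa using hθ.le))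
    rw [h1, h2, one_smul]
  have hαR : 0 < α / R := div_pos hα0 hR
  have hval : ∀ x : ℝ, Real.exp (Real.log (α / R) * x) = (α / R) ^ x := fun x =>
    (Real.rpow_def_of_pos hαR x).symm
  rw [← hGθ]
  refine interpNorm_le G (by positivity) (fun t => ?_) (fun t => ?_)
  · have h0 : (t * Complex.I : ℂ).re = 0 := by simp
    have h1 : ‖F.onLeft t‖ / ‖ψ (t * Complex.I)‖ ≤ 1 :=
      div_le_one_of_le₀ (hψl t) (norm_nonneg _)
    rw [hGL, norm_smul, hφ, h0, hval]
    calc _ = ‖ψ θ‖ * (‖F.onLeft t‖ / ‖ψ (t * Complex.I)‖) * (α / R) ^ (0 - θ) := by ring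
      _ ≤ 2 * α * 1 * (α / R) ^ (0 - θ) := by gcongr
      _ = _ := by
        rw [zero_sub, Real.rpow_neg hαR.le, Real.div_rpow hα0.le hR.le,
          Real.rpow_sub hα0, Real.rpow_one]
        field_simp
  · have h0 : (1 + t * Complex.I : ℂ).re = 1 := by simp
    rw [hGR, norm_smul, hφ, h0, hval]
    calc _ ≤ 2 * (α / R) ^ (1 - θ) * R := by
          gcongr
          · exact hq _ (by rw [h0]; exact zero_le_one)
          · exact hright t
      _ = _ := by
        rw [Real.div_rpow hα0.le hR.le, Real.rpow_sub hR, Real.rpow_one]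
        field_simp

end InterpolationCouple

/-! ### Interpolation of matrices between `ℓ²` and `ℓ^∞` -/

namespace InterpolationCouple

open Complex.HadamardThreeLines

section Matrix

variable {A B V : Type*} [NormedAddCommGroup A] [NormedSpace ℂ A]
  [NormedAddCommGroup B] [NormedSpace ℂ B] [AddCommGroup V] [Module ℂ V]
  [TopologicalSpace V] [IsTopologicalAddGroup V] [ContinuousSMul ℂ V] [T2Space V]
  {c : InterpolationCouple A B V}

/-- The scalar factor `b ^ ((r / 2) (1 - z) - 1) ((1 + θ) / (1 + z)) ^ 2`. -/
def interpFactor (θ r b : ℝ) (z : ℂ) : ℂ :=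
  Complex.exp (Real.log b * (r / 2 * (1 - z) - 1)) * ((1 + θ) / (1 + z)) ^ 2

section interpFactor

variable {θ r b : ℝ} {z : ℂ}

theorem one_le_norm_one_add (hz : 0 ≤ z.re) : 1 ≤ ‖1 + z‖ := by
  refine le_trans ?_ (Complex.re_le_norm _)
  simpa using hz

theorem one_add_ne_zero_of_re_nonneg (hz : 0 ≤ z.re) : 1 + z ≠ 0 := fun h => by
  have := one_le_norm_one_add hz
  rw [h, norm_zero] at this
  linarith

theorem differentiableAt_interpFactor (hz : 0 ≤ z.re) :
    DifferentiableAt ℂ (interpFactor θ r b) z := by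
  have := one_add_ne_zero_of_re_nonneg hz
  unfold interpFactor
  fun_prop (disch := assumption)

theorem norm_interpFactor (hθ : 0 ≤ θ) (z : ℂ) : ‖interpFactor θ r b z‖
    = Real.exp (Real.log b * (r / 2 * (1 - z.re) - 1)) * ((1 + θ) / ‖1 + z‖) ^ 2 := by
  have h1 : ‖(1 + θ : ℂ)‖ = 1 + θ := by
    have : (1 + θ : ℂ) = ((1 + θ : ℝ) : ℂ) := by push_cast; rfl
    rw [this, Complex.norm_real, Real.norm_of_nonneg (by linarith)]
  have h2 : (Real.log b * (r / 2 * (1 - z) - 1) : ℂ).re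
      = Real.log b * (r / 2 * (1 - z.re) - 1) := by
    have : (r / 2 : ℂ) = ((r / 2 : ℝ) : ℂ) := by push_cast; rfl
    rw [this, Complex.re_ofReal_mul, Complex.sub_re, Complex.re_ofReal_mul]
    simp
  rw [interpFactor, norm_mul, Complex.norm_exp, norm_pow, norm_div, h1, h2]

theorem exists_bound_interpFactor (hθ : 0 ≤ θ) (r b : ℝ) :
    ∃ M : ℝ, ∀ z ∈ verticalClosedStrip 0 1, ‖interpFactor θ r b z‖ ≤ M := by
  refine ⟨Real.exp (|Real.log b| * (|r / 2| + 1)) * (1 + θ) ^ 2, fun z hz => ?_⟩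
  rw [norm_interpFactor hθ]
  refine mul_le_mul (Real.exp_le_exp.mpr ((le_abs_self _).trans ?_)) ?_ (by positivity)
    (Real.exp_pos _).le
  · rw [abs_mul]
    refine mul_le_mul_of_nonneg_left ((abs_sub _ _).trans ?_) (abs_nonneg _)
    rw [abs_mul, abs_one]
    have h1 : |1 - z.re| ≤ 1 := by rw [abs_of_nonneg (by linarith [hz.2])]; linarith [hz.1]
    nlinarith [abs_nonneg (r / 2)]
  · have h1 := one_le_norm_one_add hz.1
    have h2 : (1 + θ) / ‖1 + z‖ ≤ 1 + θ := div_le_self (by linarith) h1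
    gcongr

theorem interpFactor_self (hθ : 0 ≤ θ) (h : r / 2 * (1 - θ) = 1) : interpFactor θ r b θ = 1 := by
  have h1 : (r / 2 * (1 - θ) - 1 : ℂ) = ((r / 2 * (1 - θ) - 1 : ℝ) : ℂ) := by push_cast; rfl
  rw [interpFactor, h1, h, sub_self, Complex.ofReal_zero, mul_zero, Complex.exp_zero, one_mul,
    div_self (one_add_ne_zero_of_re_nonneg (by simpa using hθ)), one_pow]

/-- A vector of size `b` becomes one of size `b^(r/2)`, whose square is the `b^r` of the target sum.
The decay in `t` comes from the square of `1 / (1 + z)`. -/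
theorem norm_interpFactor_left_le (hθ : 0 ≤ θ) (hθ1 : θ ≤ 1) (hb : 0 < b) (t : ℝ) :
    ‖interpFactor θ r b (t * Complex.I)‖ ≤ b ^ (r / 2 - 1) * (4 / (1 + t ^ 2)) := by
  have h0 : (t * Complex.I : ℂ).re = 0 := by simp
  have h1 : ‖(1 + t * Complex.I : ℂ)‖ ^ 2 = 1 + t ^ 2 := by
    rw [← Complex.normSq_eq_norm_sq, Complex.normSq_apply]
    simp [sq]
  rw [norm_interpFactor hθ, h0, sub_zero, mul_one, Real.rpow_def_of_pos hb, div_pow, h1]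
  gcongr
  nlinarith

/-- A vector of size `b` is normalised, as the `ℓ^∞` endpoint requires. The decaying factor costs
nothing, because `|2 + it| ≥ 2 ≥ 1 + θ`. -/
theorem norm_interpFactor_right_le (hθ : 0 ≤ θ) (hθ1 : θ ≤ 1) (hb : 0 < b) (t : ℝ) :
    ‖interpFactor θ r b (1 + t * Complex.I)‖ ≤ b⁻¹ := by
  have h0 : (1 + t * Complex.I : ℂ).re = 1 := by simp
  have h1 : 2 ≤ ‖(1 + (1 + t * Complex.I) : ℂ)‖ := by
    refine le_trans ?_ (Complex.re_le_norm _)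
    simp
    norm_num
  have h2 : (1 + θ) / ‖(1 + (1 + t * Complex.I) : ℂ)‖ ≤ 1 :=
    div_le_one_of_le₀ (by linarith) (norm_nonneg _)
  rw [norm_interpFactor hθ, h0, sub_self, mul_zero, zero_sub, mul_neg_one, Real.exp_neg,
    Real.exp_log hb]
  have h3 : ((1 + θ) / ‖(1 + (1 + t * Complex.I) : ℂ)‖) ^ 2 ≤ 1 :=
    pow_le_one₀ (by positivity) h2
  exact mul_le_of_le_one_right (by positivity) h3

end interpFactor

variable {κ τ : Type*}

/-- Interpolation of a matrix between `ℓ²(A) → ℓ²(A)` and `ℓ^∞(B) → ℓ^∞(B)`. -/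
theorem sum_interpNorm_rpow_le {θ r : ℝ} (hθ : 0 < θ) (hθ1 : θ < 1) (hr : r / 2 * (1 - θ) = 1)
    (s : Finset κ) (t : Finset τ) (C : τ → κ → ℂ) (m : κ → ℝ) (l : τ → ℝ) (b : κ → ℝ)
    (hb : ∀ k ∈ s, 0 < b k) (hm : ∀ k, 0 ≤ m k) (hl : ∀ P, 0 ≤ l P)
    (hA : ∀ a : κ → A, ∑ P ∈ t, l P * ‖∑ k ∈ s, C P k • a k‖ ^ 2 ≤ ∑ k ∈ s, m k * ‖a k‖ ^ 2)
    (hB : ∀ P, ∑ k ∈ s, ‖C P k‖ ≤ 1)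
    (F : κ → c.Admissible) {K : ℝ} (hK : 0 < K)
    (hFl : ∀ k ∈ s, ∀ y, ‖(F k).onLeft y‖ ≤ K * b k)
    (hFr : ∀ k ∈ s, ∀ y, ‖(F k).onRight y‖ ≤ K * b k) :
    ∑ P ∈ t, l P * c.interpNorm θ (∑ k ∈ s, C P k • (F k).toFun θ) ^ r
      ≤ (2 * K ^ θ) ^ r * (8192 * K ^ 2 / θ ^ 2) * ∑ k ∈ s, m k * b k ^ r := by
  set S := ∑ k ∈ s, m k * b k ^ r with hS
  have hr0 : 0 < r := by
    by_contra! h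
    nlinarith
  -- The scalar factor is `1` at `θ`, so `G_P(θ)` is the vector to be estimated. On `Re z = 0` the
  -- hypothesis `hA` applies at each height, on `Re z = 1` the row bound `hB`.
  let G : τ → c.Admissible := fun P => Admissible.combination s
    (fun k z => C P k * interpFactor θ r (b k) z) F
    (fun k z hz => (differentiableAt_interpFactor hz).const_mul _)
    (fun k => by
      obtain ⟨M, hM⟩ := exists_bound_interpFactor hθ.le r (b k)
      refine ⟨‖C P k‖ * M, fun z hz => ?_⟩
      rw [norm_mul]
      exact mul_le_mul_of_nonneg_left (hM z hz) (norm_nonneg _))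
  have hGθ : ∀ P, (G P).toFun θ = ∑ k ∈ s, C P k • (F k).toFun θ := fun P => by
    refine Finset.sum_congr rfl fun k _ => ?_
    show (C P k * interpFactor θ r (b k) θ) • (F k).toFun θ = _
    rw [interpFactor_self hθ.le hr, mul_one]
  have hGl : ∀ P (y : ℝ), (G P).onLeft y
      = ∑ k ∈ s, C P k • (interpFactor θ r (b k) (y * Complex.I) • (F k).onLeft y) :=
    fun P y => Finset.sum_congr rfl fun k _ => mul_smul _ _ _
  have hleft : ∀ k ∈ s, ∀ y : ℝ, ‖interpFactor θ r (b k) (y * Complex.I) • (F k).onLeft y‖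
      ≤ 4 * K * b k ^ (r / 2) / (1 + y ^ 2) := fun k hk y => by
    have hbk := hb k hk
    rw [norm_smul]
    refine (mul_le_mul (norm_interpFactor_left_le hθ.le hθ1.le hbk y) (hFl k hk y)
      (norm_nonneg _) (by positivity)).trans_eq ?_
    rw [Real.rpow_sub hbk, Real.rpow_one]
    field_simp
  have hGr : ∀ P y, ‖(G P).onRight y‖ ≤ K := fun P y => by
    have h1 : (G P).onRight y = ∑ k ∈ s, (C P k * interpFactor θ r (b k) (1 + y * Complex.I)) •
      (F k).onRight y := rfl
    rw [h1]
    refine (norm_sum_le _ _).trans ?_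
    have h2 : ∀ k ∈ s, ‖(C P k * interpFactor θ r (b k) (1 + y * Complex.I)) • (F k).onRight y‖
        ≤ ‖C P k‖ * K := fun k hk => by
      have hbk := hb k hk
      rw [norm_smul, norm_mul, mul_assoc]
      refine mul_le_mul_of_nonneg_left ?_ (norm_nonneg _)
      refine (mul_le_mul (norm_interpFactor_right_le hθ.le hθ1.le hbk y) (hFr k hk y)
        (norm_nonneg _) (by positivity)).trans_eq ?_
      field_simp
    refine (Finset.sum_le_sum h2).trans ?_
    rw [← Finset.sum_mul]
    exact mul_le_of_le_one_left hK.le (hB P)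
  have hbsq : ∀ k ∈ s, (b k ^ (r / 2)) ^ 2 = b k ^ r := fun k hk => by
    rw [← Real.rpow_natCast, ← Real.rpow_mul (hb k hk).le]
    congr 1
    push_cast
    ring
  have hGsq : ∀ y, ∑ P ∈ t, l P * ‖(G P).onLeft y‖ ^ 2 ≤ 16 * K ^ 2 * S / (1 + y ^ 2) ^ 2 := by
    intro y
    simp only [hGl]
    refine (hA _).trans ?_
    rw [hS, Finset.mul_sum, Finset.sum_div]
    refine Finset.sum_le_sum fun k hk => ?_
    calc _ ≤ m k * (4 * K * b k ^ (r / 2) / (1 + y ^ 2)) ^ 2 :=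
          mul_le_mul_of_nonneg_left (pow_le_pow_left₀ (norm_nonneg _) (hleft k hk y) 2) (hm k)
      _ = _ := by
        rw [div_pow, mul_pow, hbsq k hk]
        ring
  set L := ∑ P ∈ t, l P with hL
  have hL0 : 0 ≤ L := Finset.sum_nonneg fun P _ => hl P
  -- The grid depends on `ε`, but the bound only through the term `8 ε² L`, which disappears as `ε →
  -- 0`.
  have hcore : ∀ ε : ℝ, 0 < ε →
      ∑ P ∈ t, l P * c.interpNorm θ (∑ k ∈ s, C P k • (F k).toFun θ) ^ r
      ≤ (2 * K ^ θ) ^ r * (8 * ε ^ 2 * L + 8 / θ ^ 2 * (1024 * K ^ 2 * S)) := by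
    intro ε hε
    obtain ⟨n, hn, M, hgrid⟩ := exists_grid t (fun P y => ‖(G P).onLeft y‖)
      (fun P => ∑ k ∈ s, ‖C P k‖ * (4 * K * b k ^ (r / 2)))
      (fun P => (G P).onLeft.continuous.norm) (fun P y => norm_nonneg _)
      (fun P y => by
        simp only [hGl]
        refine (norm_sum_le _ _).trans ?_
        rw [Finset.sum_div]
        refine Finset.sum_le_sum fun k hk => ?_
        rw [norm_smul, mul_div_assoc]
        exact mul_le_mul_of_nonneg_left (hleft k hk y) (norm_nonneg _)) hε
    have hn' : (0 : ℝ) < n := by exact_mod_cast hn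
    set h : ℝ := (n : ℝ)⁻¹ with hh
    have hh0 : 0 < h := inv_pos.mpr hn'
    set J := Finset.Icc (-(M : ℤ)) M with hJ
    let a : τ → ℝ := fun P => ∑ j ∈ J, h * ‖(G P).onLeft (j * h)‖
    have ha0 : ∀ P, 0 ≤ a P := fun P => Finset.sum_nonneg fun j _ => by positivity
    have hw : ∑ j ∈ J, h / (1 + (j * h) ^ 2) ≤ (8 : ℝ) := sum_grid_le hn M
    have ha : ∑ P ∈ t, l P * a P ^ 2 ≤ 1024 * K ^ 2 * S := by
      have h1 : ∀ P, a P ^ 2 ≤ 8 * ∑ j ∈ J, h * (1 + (j * h) ^ 2) * ‖(G P).onLeft (j * h)‖ ^ 2 := by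
        intro P
        -- Cauchy–Schwarz with weight `1 / (1 + s²)`, `s = jh`. The decay `(1 + s²)⁻²` in `hGsq`
        -- outweighs the factor `1 + s²` and leaves the same bounded sum again, whence `8 · 16 · 8 =
        -- 1024`.
        have hcs := Finset.sum_sq_le_sum_mul_sum_of_sq_le_mul J
          (r := fun j : ℤ => h * ‖(G P).onLeft (j * h)‖)
          (f := fun j : ℤ => h / (1 + (j * h) ^ 2))
          (g := fun j : ℤ => h * (1 + (j * h) ^ 2) * ‖(G P).onLeft (j * h)‖ ^ 2)
          (fun j _ => by positivity) (fun j _ => by positivity)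
          (fun j _ => le_of_eq (by field_simp))
        refine hcs.trans (mul_le_mul_of_nonneg_right hw ?_)
        exact Finset.sum_nonneg fun j _ => by positivity
      have hS0 : 0 ≤ S := by
        rw [hS]
        exact Finset.sum_nonneg fun k hk => mul_nonneg (hm k) (Real.rpow_nonneg (hb k hk).le _)
      calc _ ≤ ∑ P ∈ t, l P *
            (8 * ∑ j ∈ J, h * (1 + (j * h) ^ 2) * ‖(G P).onLeft (j * h)‖ ^ 2) :=
            Finset.sum_le_sum fun P _ => mul_le_mul_of_nonneg_left (h1 P) (hl P)
        _ = 8 * ∑ j ∈ J, h * (1 + (j * h) ^ 2) * ∑ P ∈ t, l P * ‖(G P).onLeft (j * h)‖ ^ 2 := by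
            simp only [Finset.mul_sum]
            rw [Finset.sum_comm]
            exact Finset.sum_congr rfl fun j _ => Finset.sum_congr rfl fun P _ => by ring
        _ ≤ 8 * ∑ j ∈ J, h * (1 + (j * h) ^ 2) * (16 * K ^ 2 * S / (1 + (j * h) ^ 2) ^ 2) := by
            gcongr with j _
            exact hGsq _
        _ = 8 * (16 * K ^ 2 * S) * ∑ j ∈ J, h / (1 + (j * h) ^ 2) := by
            have h2 : ∀ j ∈ J, h * (1 + ((j : ℝ) * h) ^ 2) *
                (16 * K ^ 2 * S / (1 + ((j : ℝ) * h) ^ 2) ^ 2)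
                = 16 * K ^ 2 * S * (h / (1 + ((j : ℝ) * h) ^ 2)) := fun j _ => by field_simp
            rw [Finset.sum_congr rfl h2, ← Finset.mul_sum]
            ring
        _ ≤ 8 * (16 * K ^ 2 * S) * 8 := by gcongr
        _ = _ := by ring
    have hP : ∀ P ∈ t, c.interpNorm θ (∑ k ∈ s, C P k • (F k).toFun θ) ^ r
        ≤ (2 * K ^ θ) ^ r * (8 * ε ^ 2 + 8 / θ ^ 2 * a P ^ 2) := by
      intro P hPt
      have hα0 : 0 ≤ 2 * ε + 2 / θ * a P := by have := ha0 P; positivity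
      have h1 := interpNorm_le_grid hθ (G P) hK hε hh0 M (hGr P) (hgrid P hPt).1
        (hgrid P hPt).2 (α := 2 * ε + 2 / θ * a P) rfl
      rw [hGθ] at h1
      have h2 : 0 ≤ c.interpNorm θ (∑ k ∈ s, C P k • (F k).toFun θ) := by
        refine Real.sInf_nonneg ?_
        rintro _ ⟨F, -, rfl⟩
        exact le_max_of_le_left (norm_nonneg _)
      -- This relation turns the `r`-th power of Calderón's bound into a square, which the `ℓ²`
      -- estimate can sum over `P`.
      have h3 : (1 - θ) * r = 2 := by linarith
      refine (Real.rpow_le_rpow h2 h1 hr0.le).trans ?_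
      have h4 : 2 * (2 * ε + 2 / θ * a P) ^ (1 - θ) * K ^ θ
          = (2 * K ^ θ) * (2 * ε + 2 / θ * a P) ^ (1 - θ) := by ring
      rw [h4, Real.mul_rpow (by positivity) (by positivity), ← Real.rpow_mul hα0, h3]
      refine mul_le_mul_of_nonneg_left ?_ (by positivity)
      have h5 : (2 * ε + 2 / θ * a P) ^ (2 : ℝ) = (2 * ε + 2 / θ * a P) ^ 2 :=
        Real.rpow_natCast _ 2
      have h6 : 8 / θ ^ 2 * a P ^ 2 = 2 * (2 / θ * a P) ^ 2 := by ring
      rw [h5, h6]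
      nlinarith [sq_nonneg (2 * ε - 2 / θ * a P)]
    calc _ ≤ ∑ P ∈ t, l P * ((2 * K ^ θ) ^ r * (8 * ε ^ 2 + 8 / θ ^ 2 * a P ^ 2)) :=
          Finset.sum_le_sum fun P hPt => mul_le_mul_of_nonneg_left (hP P hPt) (hl P)
      _ = (2 * K ^ θ) ^ r * (8 * ε ^ 2 * L + 8 / θ ^ 2 * ∑ P ∈ t, l P * a P ^ 2) := by
          rw [hL, Finset.mul_sum, Finset.mul_sum, ← Finset.sum_add_distrib, Finset.mul_sum]
          exact Finset.sum_congr rfl fun P _ => by ring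
      _ ≤ _ := by gcongr
  have hlim : Filter.Tendsto (fun ε : ℝ => (2 * K ^ θ) ^ r *
      (8 * ε ^ 2 * L + 8 / θ ^ 2 * (1024 * K ^ 2 * S))) (nhdsWithin 0 (Ioi 0))
      (nhds ((2 * K ^ θ) ^ r * (8 * 0 ^ 2 * L + 8 / θ ^ 2 * (1024 * K ^ 2 * S)))) :=
    ((by fun_prop : Continuous fun ε : ℝ => (2 * K ^ θ) ^ r *
      (8 * ε ^ 2 * L + 8 / θ ^ 2 * (1024 * K ^ 2 * S))).tendsto 0).mono_left nhdsWithin_le_nhds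
  refine (ge_of_tendsto hlim (eventually_mem_nhdsWithin.mono fun ε hε => hcore ε hε)).trans_eq ?_
  ring

end Matrix

end InterpolationCouple

/-- A matrix that is bounded on weighted `ℓ²` is bounded on Hilbert space valued weighted `ℓ²`. -/
theorem sum_norm_sum_smul_sq_le {κ τ H : Type*} [NormedAddCommGroup H] [InnerProductSpace ℂ H]
    (s : Finset κ) (t : Finset τ) (C : τ → κ → ℂ) (m : κ → ℝ) (l : τ → ℝ)
    (h : ∀ a : κ → ℂ, ∑ P ∈ t, l P * ‖∑ k ∈ s, C P k * a k‖ ^ 2 ≤ ∑ k ∈ s, m k * ‖a k‖ ^ 2)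
    (a : κ → H) :
    ∑ P ∈ t, l P * ‖∑ k ∈ s, C P k • a k‖ ^ 2 ≤ ∑ k ∈ s, m k * ‖a k‖ ^ 2 := by
  -- All vectors involved lie in a finite-dimensional space; Parseval there reduces the claim to its
  -- scalar coordinates.
  let S : Submodule ℂ H := Submodule.span ℂ (a '' s)
  have hfin : FiniteDimensional ℂ S :=
    FiniteDimensional.span_of_finite ℂ (s.finite_toSet.image a)
  let b := stdOrthonormalBasis ℂ S
  have hpars : ∀ v ∈ S, ‖v‖ ^ 2 = ∑ i, ‖inner ℂ (b i : H) v‖ ^ 2 := fun v hv =>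
    (b.sum_sq_norm_inner_right ⟨v, hv⟩).symm
  have ha : ∀ k ∈ s, a k ∈ S := fun k hk => Submodule.subset_span ⟨k, hk, rfl⟩
  calc _ = ∑ P ∈ t, l P * ∑ i, ‖∑ k ∈ s, C P k * inner ℂ (b i : H) (a k)‖ ^ 2 := by
        refine Finset.sum_congr rfl fun P _ => ?_
        rw [hpars _ (S.sum_mem fun k hk => S.smul_mem _ (ha k hk))]
        simp only [inner_sum, inner_smul_right]
    _ = ∑ i, ∑ P ∈ t, l P * ‖∑ k ∈ s, C P k * inner ℂ (b i : H) (a k)‖ ^ 2 := by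
        simp only [Finset.mul_sum]
        exact Finset.sum_comm
    _ ≤ ∑ i, ∑ k ∈ s, m k * ‖inner ℂ (b i : H) (a k)‖ ^ 2 := Finset.sum_le_sum fun i _ => h _
    _ = _ := by
        rw [Finset.sum_comm]
        refine Finset.sum_congr rfl fun k hk => ?_
        rw [hpars _ (ha k hk), Finset.mul_sum]

/-- On an `r`-Hilbertian space, a matrix that is bounded on weighted `ℓ²` and whose rows are
bounded in `ℓ¹` is bounded on weighted `ℓ^r`. -/
theorem IsHilbertian.exists_matrix_bound {X : Type u} [NormedAddCommGroup X] [NormedSpace ℂ X]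
    {r : ℝ} (hr : 2 ≤ r) (hX : IsHilbertian.{u, v} r X) (τ : Type*) :
    ∃ D : ℝ, 0 ≤ D ∧ ∀ (s : Finset X) (t : Finset τ) (C : τ → X → ℂ) (m : X → ℝ) (l : τ → ℝ),
      0 ∉ s → (∀ x, 0 ≤ m x) → (∀ P, 0 ≤ l P) →
      (∀ a : X → ℂ, ∑ P ∈ t, l P * ‖∑ x ∈ s, C P x * a x‖ ^ 2 ≤ ∑ x ∈ s, m x * ‖a x‖ ^ 2) →
      (∀ P, ∑ x ∈ s, ‖C P x‖ ≤ 1) →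
      ∑ P ∈ t, l P * ‖∑ x ∈ s, C P x • x‖ ^ r ≤ D * ∑ x ∈ s, m x * ‖x‖ ^ r := by
  obtain ⟨H, _, _, _, Y, _, _, _, V, _, _, _, _, _, _, c, θ, ⟨hθ0, hθ1⟩, hrθ, e, k, K, hk, hK,
    hnorm⟩ := hX
  have hr0 : 0 < r := by linarith
  have hrθ' : r / 2 * (1 - θ) = 1 := by
    have : (1 - θ) / 2 * r = 1 := by rw [← hrθ, one_div, inv_mul_cancel₀ hr0.ne']
    linarith
  -- The value `θ = 1` would correspond to `r = ∞`.
  have hθlt : θ < 1 := by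
    by_contra! h
    nlinarith
  have hesum : ∀ (s : Finset X) (a : X → ℂ),
      ((e (∑ x ∈ s, a x • x) : c.interp θ) : c.Sum) = ∑ x ∈ s, a x • ((e x : c.interp θ) : c.Sum) :=
    fun s a => by simp only [map_sum, map_smul, Submodule.coe_sum, Submodule.coe_smul]
  rcases hθ0.eq_or_lt with rfl | hθ
  · have hr2 : r = 2 := by linarith
    subst hr2
    refine ⟨(K / k) ^ 2, by positivity, fun s t C m l h0 hm hl hA hB => ?_⟩
    choose a ha using fun x : X => InterpolationCouple.exists_inl_of_mem_interp_zero (e x).2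
    have hal : ∀ x, ‖a x‖ ≤ K * ‖x‖ := fun x => by
      refine le_trans ?_ (hnorm x).2
      rw [← ha x]
      exact InterpolationCouple.norm_le_interpNorm_zero (by rw [ha x]; exact (e x).2)
    have hP : ∀ P, ‖∑ x ∈ s, C P x • x‖ ≤ k⁻¹ * ‖∑ x ∈ s, C P x • a x‖ := fun P => by
      rw [le_inv_mul_iff₀ hk]
      refine (hnorm _).1.trans ?_
      have h1 : c.inl (∑ x ∈ s, C P x • a x) = (e (∑ x ∈ s, C P x • x) : c.interp 0) := by
        rw [InterpolationCouple.inl_sum, hesum]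
        simp only [ha]
      rw [← h1]
      exact InterpolationCouple.interpNorm_zero_le_norm (by rw [h1]; exact SetLike.coe_mem _)
    have h2 : ∀ y : ℝ, y ^ (2 : ℝ) = y ^ 2 := fun y => Real.rpow_natCast y 2
    simp only [h2]
    calc _ ≤ ∑ P ∈ t, l P * (k⁻¹ * ‖∑ x ∈ s, C P x • a x‖) ^ 2 :=
          Finset.sum_le_sum fun P _ => mul_le_mul_of_nonneg_left
            (pow_le_pow_left₀ (norm_nonneg _) (hP P) 2) (hl P)
      _ = (k⁻¹) ^ 2 * ∑ P ∈ t, l P * ‖∑ x ∈ s, C P x • a x‖ ^ 2 := by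
          rw [Finset.mul_sum]
          exact Finset.sum_congr rfl fun P _ => by ring
      _ ≤ (k⁻¹) ^ 2 * ∑ x ∈ s, m x * ‖a x‖ ^ 2 :=
          mul_le_mul_of_nonneg_left (sum_norm_sum_smul_sq_le s t C m l hA a) (by positivity)
      _ ≤ (k⁻¹) ^ 2 * ∑ x ∈ s, m x * (K * ‖x‖) ^ 2 := by
          refine mul_le_mul_of_nonneg_left (Finset.sum_le_sum fun x _ => ?_) (by positivity)
          exact mul_le_mul_of_nonneg_left (pow_le_pow_left₀ (norm_nonneg _) (hal x) 2) (hm x)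
      _ = _ := by
          rw [Finset.mul_sum, Finset.mul_sum]
          exact Finset.sum_congr rfl fun x _ => by ring
  · refine ⟨(k⁻¹) ^ r * ((2 * (2 * K) ^ θ) ^ r * (8192 * (2 * K) ^ 2 / θ ^ 2)), by positivity,
      fun s t C m l h0 hm hl hA hB => ?_⟩
    -- The infimum defining the norm need not be attained; the factor `2` leaves strict room above
    -- it when `x ≠ 0`.
    have hF : ∀ x : X, ∃ F : c.Admissible, F.toFun θ = (e x : c.interp θ) ∧ (x ≠ 0 →
        (∀ y, ‖F.onLeft y‖ ≤ 2 * K * ‖x‖) ∧ ∀ y, ‖F.onRight y‖ ≤ 2 * K * ‖x‖) := by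
      intro x
      rcases eq_or_ne x 0 with rfl | hx
      · obtain ⟨F, hF⟩ := (e 0).2
        exact ⟨F, hF, fun h => absurd rfl h⟩
      · have hx' : 0 < ‖x‖ := norm_pos_iff.mpr hx
        obtain ⟨F, hF, h⟩ := InterpolationCouple.exists_admissible (e x).2
          (C := 2 * K * ‖x‖) ((hnorm x).2.trans_lt (by nlinarith [mul_pos hK hx']))
        exact ⟨F, hF, fun _ => h⟩
    choose F hFθ hFb using hF
    have hs : ∀ x ∈ s, x ≠ 0 := fun x hx h => h0 (h ▸ hx)
    have key := InterpolationCouple.sum_interpNorm_rpow_le hθ hθlt hrθ' s t C m l (fun x => ‖x‖)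
      (fun x hx => norm_pos_iff.mpr (hs x hx)) hm hl (sum_norm_sum_smul_sq_le s t C m l hA) hB F
      (K := 2 * K) (by positivity) (fun x hx => (hFb x (hs x hx)).1)
      (fun x hx => (hFb x (hs x hx)).2)
    simp only [hFθ, ← hesum] at key
    calc _ ≤ ∑ P ∈ t, l P *
          (k⁻¹ * c.interpNorm θ (e (∑ x ∈ s, C P x • x) : c.interp θ)) ^ r := by
          refine Finset.sum_le_sum fun P _ => mul_le_mul_of_nonneg_left
            (Real.rpow_le_rpow (norm_nonneg _) ?_ hr0.le) (hl P)
          rw [le_inv_mul_iff₀ hk]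
          exact (hnorm _).1
      _ = (k⁻¹) ^ r * ∑ P ∈ t, l P *
          c.interpNorm θ (e (∑ x ∈ s, C P x • x) : c.interp θ) ^ r := by
          rw [Finset.mul_sum]
          refine Finset.sum_congr rfl fun P _ => ?_
          rw [Real.mul_rpow (by positivity)
            ((mul_nonneg hk.le (norm_nonneg _)).trans (hnorm _).1)]
          ring
      _ ≤ _ := by
          rw [mul_assoc (k⁻¹ ^ r)]
          exact mul_le_mul_of_nonneg_left key (by positivity)

/-! ### Characters and compact balls of the Walsh group -/

namespace Walsh

theorem finite_support_dot (ξ x : Walsh) :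
    (Function.support fun j : ℤ => ξ.digit j * x.digit (-1 - j)).Finite := by
  obtain ⟨N, hN⟩ := ξ.2
  obtain ⟨M, hM⟩ := x.2
  refine (Set.finite_Icc (-M) N).subset fun j hj => ?_
  rw [Function.mem_support] at hj
  constructor
  · by_contra! h
    have : x.digit (-1 - j) = 0 := hM _ (by omega)
    simp [this] at hj
  · by_contra! h
    have : ξ.digit j = 0 := hN _ h.le
    simp [this] at hj

theorem dot_add (ξ x y : Walsh) : dot ξ (x + y) = dot ξ x + dot ξ y := by
  simp only [dot, digit_add, mul_add]
  exact finsum_add_distrib (finite_support_dot ξ x) (finite_support_dot ξ y)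

theorem dot_single (ξ : Walsh) (k : ℤ) : dot ξ (single k 1) = ξ.digit (-1 - k) := by
  rw [dot, finsum_eq_single _ (-1 - k)]
  · rw [single_digit, if_pos (by omega), mul_one]
  · intro j hj
    rw [single_digit, if_neg (by omega), mul_zero]

theorem isPrimitiveRoot_exp_three :
    IsPrimitiveRoot (Complex.exp (2 * Real.pi * Complex.I / 3)) 3 := by
  have := Complex.isPrimitiveRoot_exp 3 (by norm_num)
  exact_mod_cast this

theorem expw_add (ξ x y : Walsh) : expw ξ (x + y) = expw ξ x * expw ξ y := by
  rw [expw, expw, expw, dot_add, ZMod.val_add, ← pow_add, ← pow_mod_orderOf _ (_ + _),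
    ← isPrimitiveRoot_exp_three.eq_orderOf]

theorem norm_expw (ξ x : Walsh) : ‖expw ξ x‖ = 1 := by
  rw [expw, norm_pow, isPrimitiveRoot_exp_three.norm'_eq_one (by norm_num), one_pow]

theorem expw_single (ξ : Walsh) (k : ℤ) : expw ξ (single k 1)
    = Complex.exp (2 * Real.pi * Complex.I / 3) ^ (ξ.digit (-1 - k)).val := by
  rw [expw, dot_single]

theorem expw_single_injective {ξ η : Walsh} {k : ℤ}
    (h : expw ξ (single k 1) = expw η (single k 1)) : ξ.digit (-1 - k) = η.digit (-1 - k) := by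
  rw [expw_single, expw_single] at h
  exact ZMod.val_injective 3
    (isPrimitiveRoot_exp_three.pow_inj (ZMod.val_lt _) (ZMod.val_lt _) h)

theorem continuous_expw (ξ : Walsh) : Continuous (expw ξ) := by
  obtain ⟨N, hN⟩ := ξ.2
  refine continuous_iff_continuousAt.mpr fun x => ?_
  refine (continuousAt_const (y := expw ξ x)).congr ?_
  -- On this ball `y - x` has no digits at places `≥ -N`, and `ξ` has none at places `≥ N`. Since `j
  -- < N` means `-1 - j ≥ -N`, every term of the pairing vanishes.
  filter_upwards [Metric.ball_mem_nhds x (by positivity : (0 : ℝ) < 3 ^ (-N))] with y hy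
  rw [mem_ball_iff_norm, norm_lt_zpow_iff] at hy
  have h0 : dot ξ (y - x) = 0 := by
    rw [dot]
    convert finsum_zero with j
    by_cases hj : N ≤ j
    · have : ξ.digit j = 0 := hN j hj
      rw [this, zero_mul]
    · rw [hy (-1 - j) (by omega), mul_zero]
  have h1 : expw ξ y = expw ξ x * expw ξ (y - x) := by rw [← expw_add, add_sub_cancel]
  rw [h1, expw, expw, h0, ZMod.val_zero, pow_zero, mul_one]

theorem isCompact_ball_pow (n : ℕ) : IsCompact (Metric.ball (0 : Walsh) ((3 : ℝ) ^ n)) := by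
  induction n with
  | zero => simpa using isCompact_unitBall
  | succ n ih =>
    have h : Metric.ball (0 : Walsh) ((3 : ℝ) ^ (n + 1)) ⊆
        ⋃ a : ZMod 3, (fun y => single n a + y) '' Metric.ball (0 : Walsh) ((3 : ℝ) ^ n) := by
      intro y hy
      rw [mem_iUnion]
      refine ⟨y.digit n, y - single n (y.digit n), ?_, add_sub_cancel _ _⟩
      rw [mem_ball_zero_iff] at hy ⊢
      rw [← zpow_natCast, norm_lt_zpow_iff] at hy ⊢
      intro j hj
      rw [digit_sub, single_digit]
      split_ifs with h1
      · rw [h1, sub_self]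
      · rw [hy j (by push_cast; omega), sub_zero]
    have hclosed : IsClosed (Metric.ball (0 : Walsh) ((3 : ℝ) ^ (n + 1))) := by
      rw [← isOpen_compl_iff, Metric.isOpen_iff]
      intro x hx
      refine ⟨3 ^ (n + 1), by positivity, fun y hy hy' => hx ?_⟩
      rw [mem_ball_iff_norm] at hy
      rw [mem_ball_zero_iff] at hy' ⊢
      rw [← zpow_natCast, norm_lt_zpow_iff] at hy hy' ⊢
      intro j hj
      have h2 := hy j hj
      rw [digit_sub, hy' j hj, zero_sub, neg_eq_zero] at h2
      exact h2
    exact (isCompact_iUnion fun a => ih.image (continuous_const_add _)).of_isClosed_subset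
      hclosed h

end Walsh

/-! ### Nesting of intervals -/

namespace WalshInterval

theorem measurableSet_toSet (I : WalshInterval) : MeasurableSet I.toSet :=
  Metric.isOpen_ball.measurableSet

theorem length_pos (I : WalshInterval) : 0 < I.length := by
  unfold length
  positivity

theorem center_mem (I : WalshInterval) : I.center ∈ I.toSet := mem_toSet.mpr fun _ _ => rfl

theorem add_single_mem_iff {I : WalshInterval} {k : ℤ} (hk : k < I.scale) (a : ZMod 3)
    (x : Walsh) : x + Walsh.single k a ∈ I.toSet ↔ x ∈ I.toSet := by
  simp only [mem_toSet, Walsh.digit_add, Walsh.single_digit]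
  refine forall₂_congr fun j hj => ?_
  rw [if_neg (by omega), add_zero]

/-- Two intervals with a common point are nested. -/
theorem subset_of_not_disjoint {I J : WalshInterval} (h : ¬Disjoint I.toSet J.toSet)
    (hs : I.scale ≤ J.scale) : I.toSet ⊆ J.toSet := by
  obtain ⟨x, hx, hx'⟩ := Set.not_disjoint_iff.mp h
  rw [mem_toSet] at hx hx'
  intro y hy
  rw [mem_toSet] at hy ⊢
  intro j hj
  rw [hy j (by omega), ← hx j (by omega), hx' j hj]

theorem child_subset (I : WalshInterval) (u : ZMod 3) : (I.child u).toSet ⊆ I.toSet :=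
  fun _ hx => (mem_toSet_child.mp hx).1

theorem eq_of_subset {I J : WalshInterval} (h : I.toSet ⊆ J.toSet) (hs : I.scale = J.scale) :
    I = J := by
  refine WalshInterval.ext hs (Walsh.ext_digit fun j => ?_)
  by_cases hj : j < J.scale
  · rw [I.center_low j (by omega), J.center_low j hj]
  · exact mem_toSet.mp (h I.center_mem) j (by omega)

/-- The interval of scale `n` that contains `x`. -/
def around (n : ℤ) (x : Walsh) : WalshInterval where
  scale := n
  center := ⟨fun j => if n ≤ j then x.digit j else 0, by
    obtain ⟨N, hN⟩ := x.2
    refine ⟨N, fun j hj => ?_⟩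
    have h : x.digit j = 0 := hN j hj
    show (if n ≤ j then x.digit j else 0) = 0
    rw [h, ite_self]⟩
  center_low j hj := if_neg (by omega)

theorem mem_around {n : ℤ} {x y : Walsh} :
    y ∈ (around n x).toSet ↔ ∀ j, n ≤ j → y.digit j = x.digit j := by
  rw [mem_toSet]
  refine forall₂_congr fun j (hj : n ≤ j) => ?_
  have : (around n x).center.digit j = x.digit j := if_pos hj
  rw [this]

end WalshInterval

/-! ### Wave packets: normalisation, orthogonality, Bessel's inequality -/

namespace WalshTile

/-- Two tiles are disjoint as rectangles. -/
def IsDisjoint (P Q : WalshTile) : Prop :=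
  Disjoint P.time.toSet Q.time.toSet ∨ Disjoint P.freq.toSet Q.freq.toSet

variable (P : WalshTile)

theorem wavePacket_of_mem {x : Walsh} (hx : x ∈ P.time.toSet) :
    P.wavePacket x = (P.time.length : ℂ)⁻¹ * Walsh.expw P.freq.center x := indicator_of_mem hx _

theorem wavePacket_of_notMem {x : Walsh} (hx : x ∉ P.time.toSet) : P.wavePacket x = 0 :=
  indicator_of_notMem hx _

theorem norm_wavePacket_of_mem {x : Walsh} (hx : x ∈ P.time.toSet) :
    ‖P.wavePacket x‖ = P.time.length⁻¹ := by
  rw [wavePacket_of_mem P hx, norm_mul, Walsh.norm_expw, mul_one, norm_inv, Complex.norm_real,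
    Real.norm_of_nonneg P.time.length_pos.le]

theorem norm_wavePacket_eq_indicator (x : Walsh) :
    ‖P.wavePacket x‖ = P.time.toSet.indicator (fun _ => P.time.length⁻¹) x := by
  by_cases hx : x ∈ P.time.toSet
  · rw [norm_wavePacket_of_mem P hx, indicator_of_mem hx]
  · rw [wavePacket_of_notMem P hx, norm_zero, indicator_of_notMem hx]

theorem measurable_wavePacket : Measurable P.wavePacket :=
  ((Walsh.continuous_expw _).measurable.const_mul _).indicator P.time.measurableSet_toSet

theorem volume_time_ne_top : volume P.time.toSet ≠ ∞ := by
  rw [P.time.volume_toSet]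
  exact ENNReal.ofReal_ne_top

theorem memLp_wavePacket (p : ℝ≥0∞) : MemLp P.wavePacket p volume := by
  have h : MemLp (P.time.toSet.indicator fun _ => (P.time.length : ℝ)⁻¹) p volume :=
    memLp_indicator_const p P.time.measurableSet_toSet _ (Or.inr P.volume_time_ne_top)
  refine h.of_le P.measurable_wavePacket.aestronglyMeasurable (Filter.Eventually.of_forall ?_)
  intro x
  rw [norm_wavePacket_eq_indicator]
  exact le_abs_self _

theorem integrable_wavePacket : Integrable P.wavePacket volume :=
  memLp_one_iff_integrable.mp (P.memLp_wavePacket 1)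

theorem lintegral_enorm_wavePacket : ∫⁻ x, ‖P.wavePacket x‖ₑ = 1 := by
  have h : ∀ x, ‖P.wavePacket x‖ₑ
      = P.time.toSet.indicator (fun _ => ENNReal.ofReal P.time.length⁻¹) x := fun x => by
    rw [← ofReal_norm, norm_wavePacket_eq_indicator]
    by_cases hx : x ∈ P.time.toSet <;> simp [hx]
  simp only [h]
  rw [lintegral_indicator_const P.time.measurableSet_toSet, P.time.volume_toSet,
    ← ENNReal.ofReal_mul (inv_nonneg.mpr P.time.length_pos.le),
    inv_mul_cancel₀ P.time.length_pos.ne', ENNReal.ofReal_one]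

theorem integral_norm_wavePacket : ∫ x, ‖P.wavePacket x‖ = 1 := by
  rw [integral_norm_eq_lintegral_enorm P.integrable_wavePacket.1, lintegral_enorm_wavePacket,
    ENNReal.toReal_one]

theorem integral_wavePacket_mul_conj_self :
    ∫ x, P.wavePacket x * starRingEnd ℂ (P.wavePacket x) = (P.time.length : ℂ)⁻¹ := by
  have hl := P.time.length_pos
  have h : ∀ x, P.wavePacket x * starRingEnd ℂ (P.wavePacket x)
      = P.time.toSet.indicator (fun _ => (((P.time.length)⁻¹ ^ 2 : ℝ) : ℂ)) x := fun x => by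
    rw [Complex.mul_conj, Complex.normSq_eq_norm_sq, norm_wavePacket_eq_indicator]
    by_cases hx : x ∈ P.time.toSet <;> simp [hx]
  simp only [h]
  rw [integral_indicator_const _ P.time.measurableSet_toSet, Measure.real, P.time.volume_toSet,
    ENNReal.toReal_ofReal hl.le, Complex.real_smul, ← Complex.ofReal_mul, ← Complex.ofReal_inv]
  congr 1
  field_simp

/-- If the centres agreed at all places at or above both scales, the centre of the interval of
smaller scale would lie in the other one. -/
theorem exists_digit_ne {I J : WalshInterval} (h : Disjoint I.toSet J.toSet) :
    ∃ j, I.scale ≤ j ∧ J.scale ≤ j ∧ I.center.digit j ≠ J.center.digit j := by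
  by_contra! hne
  rcases le_total I.scale J.scale with hs | hs
  · exact Set.disjoint_left.mp h I.center_mem
      (WalshInterval.mem_toSet.mpr fun j hj => hne j (hs.trans hj) hj)
  · exact Set.disjoint_left.mp h
      (WalshInterval.mem_toSet.mpr fun j hj => (hne j hj (hs.trans hj)).symm) J.center_mem

theorem wavePacket_add_single {k : ℤ} (hk : k < P.time.scale) (x : Walsh) :
    P.wavePacket (x + Walsh.single k 1)
      = P.wavePacket x * Walsh.expw P.freq.center (Walsh.single k 1) := by
  by_cases hx : x ∈ P.time.toSet
  · rw [wavePacket_of_mem P hx,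
      wavePacket_of_mem P ((WalshInterval.add_single_mem_iff hk 1 x).mpr hx), Walsh.expw_add,
      mul_assoc]
  · rw [wavePacket_of_notMem P hx, zero_mul,
      wavePacket_of_notMem P (mt (WalshInterval.add_single_mem_iff hk 1 x).mp hx)]

/-- If the frequency intervals are disjoint, their centres differ at a digit `j` at or above both
scales. Translation in the dual digit `-1 - j` preserves both time intervals and multiplies the
integrand by a constant other than `1`; invariance of Haar measure forces the integral to vanish. -/
theorem integral_wavePacket_mul_conj_eq_zero {P Q : WalshTile} (h : P.IsDisjoint Q) :
    ∫ x, P.wavePacket x * starRingEnd ℂ (Q.wavePacket x) = 0 := by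
  rcases h with h | h
  · have h0 : ∀ x, P.wavePacket x * starRingEnd ℂ (Q.wavePacket x) = 0 := fun x => by
      by_cases hx : x ∈ P.time.toSet
      · rw [Q.wavePacket_of_notMem (Set.disjoint_left.mp h hx), map_zero, mul_zero]
      · rw [P.wavePacket_of_notMem hx, zero_mul]
    simp only [h0, integral_zero]
  · obtain ⟨j, hjP, hjQ, hne⟩ := exists_digit_ne h
    have hP := P.area
    have hQ := Q.area
    -- As the scales of a tile add up to `0`, `j` being at least both frequency scales means that
    -- `k` lies below both time scales.
    set k : ℤ := -1 - j with hk
    set g : Walsh → ℂ := fun x => P.wavePacket x * starRingEnd ℂ (Q.wavePacket x) with hg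
    set a := Walsh.expw P.freq.center (Walsh.single k 1)
    set b := Walsh.expw Q.freq.center (Walsh.single k 1)
    have htrans : ∀ x, g (x + Walsh.single k 1) = a * starRingEnd ℂ b * g x := fun x => by
      simp only [hg]
      rw [P.wavePacket_add_single (by omega), Q.wavePacket_add_single (by omega), map_mul]
      ring
    have hint : ∫ x, g x = a * starRingEnd ℂ b * ∫ x, g x := by
      rw [← integral_const_mul, ← integral_add_right_eq_self g (Walsh.single k 1)]
      simp only [htrans]
    by_contra h0
    have hab : a * starRingEnd ℂ b = 1 := by
      have h1 : 1 * ∫ x, g x = a * starRingEnd ℂ b * ∫ x, g x := by rw [one_mul]; exact hint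
      exact (mul_right_cancel₀ h0 h1).symm
    have hb : b * starRingEnd ℂ b = 1 := by
      rw [Complex.mul_conj, Complex.normSq_eq_norm_sq, Walsh.norm_expw]
      simp
    have hb0 : starRingEnd ℂ b ≠ 0 := fun h1 => by simp [h1] at hb
    have heq := Walsh.expw_single_injective (mul_right_cancel₀ hb0 (hab.trans hb.symm))
    have : -1 - k = j := by omega
    rw [this] at heq
    exact hne heq

/-- Bessel's inequality for the wave packets of pairwise disjoint tiles. -/
theorem sum_norm_integral_sq_le {t : Finset WalshTile}
    (ht : ∀ P ∈ t, ∀ Q ∈ t, P ≠ Q → P.IsDisjoint Q) {f : Walsh → ℂ} (hf : MemLp f 2 volume) :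
    ∑ P ∈ t, P.time.length * ‖∫ x, P.wavePacket x * f x‖ ^ 2 ≤ ∫ x, ‖f x‖ ^ 2 := by
  -- The packet has `L²` norm `|I_P|^(-1/2)`, hence the factor `√|I_P|`; the conjugate undoes that
  -- of the inner product, since the pairing is bilinear.
  have hmem : ∀ P : WalshTile,
      MemLp (fun x => (Real.sqrt P.time.length : ℂ) * starRingEnd ℂ (P.wavePacket x)) 2 volume :=
    fun P => ((P.memLp_wavePacket 2).star).const_mul _
  have hinner : ∀ (P : WalshTile) {g : Walsh → ℂ} (hg : MemLp g 2 volume),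
      inner ℂ (hmem P).toLp hg.toLp
        = (Real.sqrt P.time.length : ℂ) * ∫ x, P.wavePacket x * g x := by
    intro P g hg
    rw [L2.inner_def, ← integral_const_mul]
    refine integral_congr_ae ?_
    filter_upwards [(hmem P).coeFn_toLp, hg.coeFn_toLp] with x h1 h2
    rw [h1, h2, RCLike.inner_apply, map_mul, Complex.conj_conj, Complex.conj_ofReal]
    ring
  have hON : Orthonormal ℂ fun P : t => (hmem P).toLp := by
    classical
    rw [orthonormal_iff_ite]
    rintro ⟨P, hP⟩ ⟨Q, hQ⟩
    rw [hinner P (hmem Q)]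
    have h1 : ∀ x, P.wavePacket x * ((Real.sqrt Q.time.length : ℂ) *
        starRingEnd ℂ (Q.wavePacket x)) = (Real.sqrt Q.time.length : ℂ) *
        (P.wavePacket x * starRingEnd ℂ (Q.wavePacket x)) := fun x => by ring
    simp only [h1, integral_const_mul]
    split_ifs with h
    · rw [Subtype.mk.injEq] at h
      subst h
      rw [integral_wavePacket_mul_conj_self, ← mul_assoc, ← Complex.ofReal_mul,
        Real.mul_self_sqrt P.time.length_pos.le]
      exact mul_inv_cancel₀ (by exact_mod_cast P.time.length_pos.ne')
    · rw [Subtype.mk.injEq] at h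
      rw [integral_wavePacket_mul_conj_eq_zero (ht P hP Q hQ h), mul_zero, mul_zero]
  have hbessel := hON.sum_inner_products_le (s := Finset.univ) hf.toLp
  have hnorm : ‖hf.toLp‖ ^ 2 = ∫ x, ‖f x‖ ^ 2 := by
    have h1 := inner_self_eq_norm_sq_to_K (𝕜 := ℂ) hf.toLp
    rw [L2.inner_def] at h1
    have h2 : ∫ x, inner ℂ ((hf.toLp f : Walsh → ℂ) x) ((hf.toLp f : Walsh → ℂ) x) = ((∫ x, ‖f x‖ ^ 2 : ℝ) : ℂ) := by
      rw [← integral_complex_ofReal]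
      refine integral_congr_ae ?_
      filter_upwards [hf.coeFn_toLp] with x hx
      rw [hx, inner_self_eq_norm_sq_to_K]
      push_cast
      rfl
    rw [h2] at h1
    apply Complex.ofReal_injective
    rw [h1]
    push_cast
    rfl
  rw [hnorm] at hbessel
  refine le_of_eq_of_le ?_ hbessel
  rw [← Finset.sum_coe_sort]
  refine Finset.sum_congr rfl fun P _ => ?_
  rw [hinner P.1 hf, norm_mul, mul_pow, Complex.norm_real, Real.norm_of_nonneg (Real.sqrt_nonneg _),
    Real.sq_sqrt P.1.time.length_pos.le]

end WalshTile

/-! ### Schwartz functions as simple functions -/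

namespace IsWalshSchwartz

variable {X : Type*} [NormedAddCommGroup X] {f : Walsh → X}

theorem isLocallyConstant (hf : IsWalshSchwartz f) : IsLocallyConstant f := by
  obtain ⟨N, -, -, hN⟩ := hf
  rw [IsLocallyConstant.iff_eventually_eq]
  intro x
  -- Scale `-N - 1`, because constancy is assumed only on intervals of measure strictly less than
  -- `3^(-N)`.
  filter_upwards [Metric.ball_mem_nhds x (by positivity : (0 : ℝ) < 3 ^ (-(N : ℤ) - 1))] with y hy
  rw [mem_ball_iff_norm, Walsh.norm_lt_zpow_iff] at hy
  refine hN (WalshInterval.around (-(N : ℤ) - 1) x) ?_ y ?_ x ?_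
  · exact zpow_lt_zpow_right₀ (by norm_num) (show -(N : ℤ) - 1 < -(N : ℤ) by omega)
  · rw [WalshInterval.mem_around]
    intro j hj
    exact sub_eq_zero.mp (hy j hj)
  · rw [WalshInterval.mem_around]
    exact fun _ _ => rfl

theorem finite_range (hf : IsWalshSchwartz f) : (range f).Finite := by
  have hlc := hf.isLocallyConstant
  obtain ⟨N, -, h0, -⟩ := hf
  have : CompactSpace (Metric.ball (0 : Walsh) ((3 : ℝ) ^ N)) :=
    isCompact_iff_compactSpace.mp (Walsh.isCompact_ball_pow N)
  have h1 := (hlc.comp_continuous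
    (continuous_subtype_val (p := (· ∈ Metric.ball (0 : Walsh) ((3 : ℝ) ^ N))))).range_finite
  refine (h1.insert 0).subset ?_
  rintro _ ⟨x, rfl⟩
  by_cases hx : x ∈ Metric.ball (0 : Walsh) ((3 : ℝ) ^ N)
  · exact Or.inr ⟨⟨x, hx⟩, rfl⟩
  · exact Or.inl (h0 x hx)

/-- The values of a Schwartz function other than `0`. -/
def values (hf : IsWalshSchwartz f) : Finset X :=
  (hf.finite_range.subset (sdiff_subset (t := {0}))).toFinset

theorem mem_values (hf : IsWalshSchwartz f) {x : X} : x ∈ hf.values ↔ x ∈ range f ∧ x ≠ 0 := by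
  simp [values]

theorem measurableSet_fiber (hf : IsWalshSchwartz f) (x : X) : MeasurableSet (f ⁻¹' {x}) :=
  (hf.isLocallyConstant.isOpen_fiber x).measurableSet

theorem volume_fiber_ne_top (hf : IsWalshSchwartz f) {x : X} (hx : x ≠ 0) :
    volume (f ⁻¹' {x}) ≠ ∞ := by
  obtain ⟨N, -, h0, -⟩ := hf
  refine ne_top_of_le_ne_top (b := volume (Metric.ball (0 : Walsh) ((3 : ℝ) ^ (N : ℤ)))) ?_
    (measure_mono ?_)
  · rw [Walsh.vol_zpow]
    exact ENNReal.ofReal_ne_top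
  · intro y hy
    by_contra hy'
    exact hx ((mem_singleton_iff.mp hy).symm.trans (h0 y (by rwa [zpow_natCast] at hy')))

/-- The sum omits the value `0`, whose fibre has infinite measure; this is why `G 0 = 0` is
required. -/
theorem apply_eq_sum (hf : IsWalshSchwartz f) {M : Type*} [AddCommMonoid M] {G : X → M}
    (hG : G 0 = 0) (y : Walsh) :
    G (f y) = ∑ x ∈ hf.values, (f ⁻¹' {x}).indicator (fun _ => G x) y := by
  classical
  by_cases h0 : f y = 0
  · rw [h0, hG, Finset.sum_eq_zero]
    intro x hx
    refine indicator_of_notMem (fun hy => (hf.mem_values.mp hx).2 ?_) _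
    exact (mem_singleton_iff.mp hy).symm.trans h0
  · rw [Finset.sum_eq_single (f y)]
    · rw [indicator_of_mem (show y ∈ f ⁻¹' {f y} from rfl)]
    · intro x _ hx
      exact indicator_of_notMem (s := f ⁻¹' {x}) (fun hy => hx (mem_singleton_iff.mp hy).symm) _
    · intro h
      exact absurd (hf.mem_values.mpr ⟨⟨y, rfl⟩, h0⟩) h

theorem lintegral_comp (hf : IsWalshSchwartz f) {G : X → ℝ≥0∞} (hG : G 0 = 0) :
    ∫⁻ y, G (f y) = ∑ x ∈ hf.values, volume (f ⁻¹' {x}) * G x := by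
  simp only [hf.apply_eq_sum hG]
  rw [lintegral_finsetSum _ fun x _ => measurable_const.indicator (hf.measurableSet_fiber x)]
  refine Finset.sum_congr rfl fun x _ => ?_
  rw [lintegral_indicator_const (hf.measurableSet_fiber x), mul_comm]

theorem lintegral_enorm_rpow_ne_top (hf : IsWalshSchwartz f) {p : ℝ} (hp : 0 < p) :
    ∫⁻ y, ‖f y‖ₑ ^ p ≠ ∞ := by
  rw [hf.lintegral_comp (G := fun x => ‖x‖ₑ ^ p) (by simp [hp])]
  refine ENNReal.sum_ne_top.mpr fun x hx => ENNReal.mul_ne_top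
    (hf.volume_fiber_ne_top (hf.mem_values.mp hx).2)
    (ENNReal.rpow_ne_top_of_nonneg hp.le enorm_ne_top)

theorem aestronglyMeasurable (hf : IsWalshSchwartz f) : AEStronglyMeasurable f volume := by
  have h : f = fun y => ∑ x ∈ hf.values, (f ⁻¹' {x}).indicator (fun _ => x) y :=
    funext fun y => hf.apply_eq_sum (G := id) rfl y
  rw [h]
  exact (Finset.stronglyMeasurable_fun_sum _ fun x _ =>
    stronglyMeasurable_const.indicator (hf.measurableSet_fiber x)).aestronglyMeasurable

theorem bounded (hf : IsWalshSchwartz f) : ∃ C : ℝ, ∀ y, ‖f y‖ ≤ C := by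
  obtain ⟨C, hC⟩ := (hf.finite_range.image norm).bddAbove
  exact ⟨C, fun y => hC ⟨_, ⟨y, rfl⟩, rfl⟩⟩

/-- The part of a Schwartz function where its values belong to a given set. -/
theorem indicator_preimage (hf : IsWalshSchwartz f) (S : Set X) :
    IsWalshSchwartz ((f ⁻¹' S).indicator f) := by
  classical
  obtain ⟨N, hN, h0, hc⟩ := hf
  refine ⟨N, hN, fun x hx => ?_, fun I hI x hx y hy => ?_⟩
  · rw [indicator_apply, h0 x hx, ite_self]
  · have := hc I hI x hx y hy
    simp only [indicator_apply, mem_preimage, this]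

variable [NormedSpace ℂ X]

theorem integrable_wavePacket_smul (hf : IsWalshSchwartz f) (P : WalshTile) :
    Integrable (fun y => P.wavePacket y • f y) volume := by
  obtain ⟨C, hC⟩ := hf.bounded
  exact P.integrable_wavePacket.smul_bdd C hf.aestronglyMeasurable (Filter.Eventually.of_forall hC)

theorem walshPairing_eq_sum [CompleteSpace X] (hf : IsWalshSchwartz f) (P : WalshTile) :
    walshPairing f P.wavePacket = ∑ x ∈ hf.values, (∫ y in f ⁻¹' {x}, P.wavePacket y) • x := by
  have h : ∀ y, P.wavePacket y • f y
      = ∑ x ∈ hf.values, (f ⁻¹' {x}).indicator P.wavePacket y • x := fun y => by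
    rw [hf.apply_eq_sum (G := fun x => P.wavePacket y • x) (smul_zero _) y]
    refine Finset.sum_congr rfl fun x _ => ?_
    by_cases hy : y ∈ f ⁻¹' {x}
    · rw [indicator_of_mem hy, indicator_of_mem hy]
    · rw [indicator_of_notMem hy, indicator_of_notMem hy, zero_smul]
  rw [walshPairing]
  simp only [h]
  rw [integral_finsetSum _ fun x _ =>
    (P.integrable_wavePacket.indicator (hf.measurableSet_fiber x)).smul_const x]
  refine Finset.sum_congr rfl fun x _ => ?_
  rw [integral_smul_const, integral_indicator (hf.measurableSet_fiber x)]

end IsWalshSchwartz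

/-- An `r`-Hilbertian space has tile type `r`. -/
theorem IsHilbertian.exists_tile_bound {X : Type u} [NormedAddCommGroup X] [NormedSpace ℂ X]
    [CompleteSpace X] {r : ℝ} (hr : 2 ≤ r) (hX : IsHilbertian.{u, v} r X) :
    ∃ D : ℝ, 0 ≤ D ∧ ∀ f : Walsh → X, IsWalshSchwartz f → ∀ t : Finset WalshTile,
      (∀ P ∈ t, ∀ Q ∈ t, P ≠ Q → P.IsDisjoint Q) →
      ∑ P ∈ t, ENNReal.ofReal P.time.length * ‖walshPairing f P.wavePacket‖ₑ ^ r
        ≤ ENNReal.ofReal D * ∫⁻ y, ‖f y‖ₑ ^ r := by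
  have hr0 : 0 < r := by linarith
  obtain ⟨D, hD, h⟩ := hX.exists_matrix_bound hr WalshTile
  refine ⟨D, hD, fun f hf t ht => ?_⟩
  have hmeas := hf.measurableSet_fiber
  -- The nonzero values of `f` index the columns, weighted by the measures of their fibres; the
  -- tiles index the rows, weighted by `|I_P|`.
  have key := h hf.values t (fun P x => ∫ y in f ⁻¹' {x}, P.wavePacket y)
    (fun x => (volume (f ⁻¹' {x})).toReal) (fun P => P.time.length)
    (fun h0 => (hf.mem_values.mp h0).2 rfl) (fun x => ENNReal.toReal_nonneg)
    (fun P => P.time.length_pos.le) ?_ ?_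
  · simp only [← hf.walshPairing_eq_sum] at key
    have e1 : ∀ x : X, ‖x‖ₑ ^ r = ENNReal.ofReal (‖x‖ ^ r) := fun x => by
      rw [← ofReal_norm, ENNReal.ofReal_rpow_of_nonneg (norm_nonneg _) hr0.le]
    rw [hf.lintegral_comp (G := fun x => ‖x‖ₑ ^ r) (by simp [hr0])]
    have e2 : ∑ x ∈ hf.values, volume (f ⁻¹' {x}) * ‖x‖ₑ ^ r
        = ENNReal.ofReal (∑ x ∈ hf.values, (volume (f ⁻¹' {x})).toReal * ‖x‖ ^ r) := by
      rw [ENNReal.ofReal_sum_of_nonneg fun x _ => by positivity]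
      refine Finset.sum_congr rfl fun x hx => ?_
      rw [ENNReal.ofReal_mul ENNReal.toReal_nonneg,
        ENNReal.ofReal_toReal (hf.volume_fiber_ne_top (hf.mem_values.mp hx).2), e1]
    rw [e2, ← ENNReal.ofReal_mul hD]
    refine le_trans (le_of_eq ?_) (ENNReal.ofReal_le_ofReal key)
    rw [ENNReal.ofReal_sum_of_nonneg fun P _ =>
      mul_nonneg P.time.length_pos.le (Real.rpow_nonneg (norm_nonneg _) _)]
    refine Finset.sum_congr rfl fun P _ => ?_
    rw [ENNReal.ofReal_mul P.time.length_pos.le, e1]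
  · intro a
    -- Replacing each value `x` by the scalar `a x` turns the `ℓ²` hypothesis on the matrix into
    -- Bessel's inequality for `g`.
    set g : Walsh → ℂ := fun y => ∑ x ∈ hf.values, (f ⁻¹' {x}).indicator (fun _ => a x) y with hg
    have hg2 : MemLp g 2 volume := memLp_finsetSum _ fun x hx =>
      memLp_indicator_const 2 (hmeas x) _
        (Or.inr (hf.volume_fiber_ne_top (hf.mem_values.mp hx).2))
    have hb := WalshTile.sum_norm_integral_sq_le ht hg2
    refine le_of_eq_of_le (Finset.sum_congr rfl fun P _ => ?_) (hb.trans_eq ?_)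
    · congr 3
      simp only [hg, Finset.mul_sum]
      have h1 : ∀ x y, P.wavePacket y * (f ⁻¹' {x}).indicator (fun _ => a x) y
          = (f ⁻¹' {x}).indicator P.wavePacket y * a x := fun x y => by
        by_cases hy : y ∈ f ⁻¹' {x}
        · rw [indicator_of_mem hy, indicator_of_mem hy]
        · rw [indicator_of_notMem hy, indicator_of_notMem hy, mul_zero, zero_mul]
      simp only [h1]
      rw [integral_finsetSum _ fun x _ =>
        (P.integrable_wavePacket.indicator (hmeas x)).mul_const _]
      refine Finset.sum_congr rfl fun x _ => ?_
      rw [integral_mul_const, integral_indicator (hmeas x)]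
    · classical
      -- Resetting the coefficient at `0` makes `g = b ∘ f` hold on the zero set of `f` too.
      let b : X → ℂ := fun x => if x = 0 then 0 else a x
      have hb' : ∀ x ∈ hf.values, b x = a x := fun x hx => if_neg (hf.mem_values.mp hx).2
      have h2 : ∀ y, ‖g y‖ ^ 2
          = ∑ x ∈ hf.values, (f ⁻¹' {x}).indicator (fun _ => ‖a x‖ ^ 2) y := fun y => by
        have h3 : g y = b (f y) := by
          rw [hf.apply_eq_sum (G := b) (if_pos rfl) y, hg]
          exact Finset.sum_congr rfl fun x hx => by rw [hb' x hx]
        rw [h3, hf.apply_eq_sum (G := fun x => ‖b x‖ ^ 2) (by simp [b]) y]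
        exact Finset.sum_congr rfl fun x hx => by rw [hb' x hx]
      simp only [h2]
      rw [integral_finsetSum _ fun x hx => (integrable_indicator_iff (hmeas x)).mpr
        (integrableOn_const (hf.volume_fiber_ne_top (hf.mem_values.mp hx).2))]
      refine Finset.sum_congr rfl fun x _ => ?_
      rw [integral_indicator_const _ (hmeas x), Measure.real, smul_eq_mul]
  · intro P
    -- The fibres are disjoint and `‖w_P‖₁ = 1`, so each row has `ℓ¹` norm at most `1`.
    refine (Finset.sum_le_sum fun x _ => norm_integral_le_integral_norm _).trans ?_
    rw [← integral_biUnion_finset _ (fun x _ => hmeas x) ?_ fun x _ =>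
      P.integrable_wavePacket.norm.integrableOn, ← P.integral_norm_wavePacket]
    · exact setIntegral_le_integral P.integrable_wavePacket.norm
        (Filter.Eventually.of_forall fun _ => norm_nonneg _)
    · intro x _ x' _ hne
      refine Set.disjoint_left.mpr fun y hy hy' => hne ?_
      exact (mem_singleton_iff.mp hy).symm.trans (mem_singleton_iff.mp hy')

namespace WalshTile

theorem not_isDisjoint_self (P : WalshTile) : ¬P.IsDisjoint P := by
  rintro (h | h)
  · exact Set.disjoint_left.mp h P.time.center_mem P.time.center_mem
  · exact Set.disjoint_left.mp h P.freq.center_mem P.freq.center_mem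

end WalshTile

/-! ### Pointwise bounds for the embedding, and truncation -/

section Pairing

variable {X : Type*} [NormedAddCommGroup X] [NormedSpace ℂ X] {f : Walsh → X}

theorem enorm_walshPairing_le {M : ℝ≥0∞} (hM : ∀ᵐ y, ‖f y‖ₑ ≤ M) (P : WalshTile) :
    ‖walshPairing f P.wavePacket‖ₑ ≤ M := by
  refine (enorm_integral_le_lintegral_enorm _).trans ?_
  calc _ ≤ ∫⁻ y, ‖P.wavePacket y‖ₑ * M := by
        refine lintegral_mono_ae (hM.mono fun y hy => ?_)
        rw [enorm_smul]
        gcongr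
    _ = M := by
        rw [lintegral_mul_const _ P.measurable_wavePacket.enorm, P.lintegral_enorm_wavePacket,
          one_mul]

/-- Holds because `|I_P| |w_P| ≤ 1`. It bounds the scales of the tritiles in a level set. -/
theorem length_mul_norm_walshPairing_le (hf : IsWalshSchwartz f) (P : WalshTile) :
    P.time.length * ‖walshPairing f P.wavePacket‖ ≤ ∫ y, ‖f y‖ := by
  have hl := P.time.length_pos
  have hint : Integrable f volume := by
    refine ⟨hf.aestronglyMeasurable, ?_⟩
    have := hf.lintegral_enorm_rpow_ne_top one_pos
    simp only [ENNReal.rpow_one] at this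
    exact lt_top_iff_ne_top.mpr this
  rw [← le_inv_mul_iff₀ hl, ← integral_const_mul]
  refine (norm_integral_le_integral_norm _).trans (integral_mono
    (hf.integrable_wavePacket_smul P).norm (hint.norm.const_mul _) fun y => ?_)
  simp only [norm_smul, WalshTile.norm_wavePacket_eq_indicator]
  refine mul_le_mul_of_nonneg_right (indicator_le_self' (fun _ _ => ?_) y) (norm_nonneg _)
  exact inv_nonneg.mpr hl.le

theorem exists_lt_norm_embedding {t : ℝ} (ht : 0 ≤ t) {P : Tritile} (h : t < ‖embedding f P‖) :
    ∃ u, t < ‖walshPairing f (P.tile u).wavePacket‖ := by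
  by_contra! hle
  exact absurd ((pi_norm_le_iff_of_nonneg ht).mpr hle) (not_le.mpr h)

theorem norm_embedding_le {C : ℝ} (hC : 0 ≤ C) (hf : ∀ y, ‖f y‖ ≤ C) (P : Tritile) :
    ‖embedding f P‖ ≤ C := by
  refine (pi_norm_le_iff_of_nonneg hC).mpr fun u => ?_
  have h := enorm_walshPairing_le (f := f) (M := ENNReal.ofReal C)
    (Filter.Eventually.of_forall fun y => by
      rw [← ofReal_norm]
      exact ENNReal.ofReal_le_ofReal (hf y)) (P.tile u)
  rw [← ofReal_norm] at h
  exact (ENNReal.ofReal_le_ofReal_iff hC).mp h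

theorem embedding_add {g : Walsh → X} (hf : IsWalshSchwartz f) (hg : IsWalshSchwartz g)
    (P : Tritile) : embedding (fun y => f y + g y) P = embedding f P + embedding g P := by
  funext u
  simp only [embedding, walshPairing, smul_add, Pi.add_apply]
  exact integral_add (hf.integrable_wavePacket_smul _) (hg.integrable_wavePacket_smul _)

/-- Where the embedding of `f` exceeds `t`, the embedding of the part of `f` above height `t / 2`
exceeds `t / 2`. -/
theorem levelSet_subset_truncated (hf : IsWalshSchwartz f) {t : ℝ} (ht : 0 < t) :
    {P | t < ‖embedding f P‖}
      ⊆ {P | t / 2 < ‖embedding ((f ⁻¹' {x | t / 2 < ‖x‖}).indicator f) P‖} := by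
  intro P hP
  rw [mem_ofPred_eq] at hP ⊢
  have h1 := hf.indicator_preimage {x | t / 2 < ‖x‖}
  have h2 := hf.indicator_preimage {x | t / 2 < ‖x‖}ᶜ
  have hsum : f = fun y => (f ⁻¹' {x | t / 2 < ‖x‖}).indicator f y
      + (f ⁻¹' {x | t / 2 < ‖x‖}ᶜ).indicator f y := by
    rw [preimage_compl]
    exact (indicator_self_add_compl _ f).symm
  have h3 : ‖embedding ((f ⁻¹' {x | t / 2 < ‖x‖}ᶜ).indicator f) P‖ ≤ t / 2 := by
    refine norm_embedding_le (by positivity) (fun y => ?_) P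
    by_cases hy : y ∈ f ⁻¹' {x | t / 2 < ‖x‖}ᶜ
    · rw [indicator_of_mem hy]
      exact not_lt.mp hy
    · rw [indicator_of_notMem hy, norm_zero]
      positivity
  have h4 : embedding f P = embedding ((f ⁻¹' {x | t / 2 < ‖x‖}).indicator f) P
      + embedding ((f ⁻¹' {x | t / 2 < ‖x‖}ᶜ).indicator f) P := by
    rw [← embedding_add h1 h2, ← hsum]
  rw [h4] at hP
  have h5 := norm_add_le (embedding ((f ⁻¹' {x | t / 2 < ‖x‖}).indicator f) P)
    (embedding ((f ⁻¹' {x | t / 2 < ‖x‖}ᶜ).indicator f) P)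
  linarith

end Pairing

/-! ### Outer measure and covers by maximal trees -/

section Outer

theorem inducedOuter_mono {ι 𝕏 : Type*} (E : ι → Set 𝕏) (σ : ι → ℝ≥0∞) {A B : Set 𝕏}
    (h : A ⊆ B) : inducedOuter E σ A ≤ inducedOuter E σ B :=
  iInf₂_mono fun _ _ => le_iInf fun hB => iInf_le _ (h.trans hB)

/-- A family of nonzero weights whose finite sums have a finite bound is countable, so countability
of the cover need not be checked beforehand. -/
theorem inducedOuter_le_of_sum_le {ι 𝕏 : Type*} {E : ι → Set 𝕏} {σ : ι → ℝ≥0∞}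
    (hσ : ∀ i, σ i ≠ 0) {A : Set 𝕏} {B : Set ι} (hA : A ⊆ ⋃ i ∈ B, E i) {M : ℝ≥0∞}
    (hM : ∀ t : Finset B, ∑ i ∈ t, σ i ≤ M) : inducedOuter E σ A ≤ M := by
  rcases eq_or_ne M ∞ with rfl | hM'
  · exact le_top
  have htsum : ∑' i : B, σ i ≤ M := by
    rw [ENNReal.tsum_eq_iSup_sum]
    exact iSup_le hM
  have hc : B.Countable := by
    have h1 := Summable.countable_support_ennreal (ne_top_of_le_ne_top hM' htsum)
    have h2 : (Function.support fun i : B => σ i) = univ :=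
      eq_univ_of_forall fun i => hσ i
    rw [h2, countable_univ_iff] at h1
    exact countable_coe_iff.mp h1
  exact (iInf₂_le_of_le B hc (iInf_le _ hA)).trans htsum

theorem superlevel_le_inducedOuter {f : Tritile → ℝ} (hf : ∀ P, 0 ≤ f P) (t : ℝ) :
    superlevel Tritile.tree treePremeasure sizeSup (fun P => (f P : ℂ)) t
      ≤ inducedOuter Tritile.tree treePremeasure {P | t < f P} := by
  refine iInf₂_le_of_le {P | t < f P} ?_ le_rfl
  refine iSup_le fun T => iSup₂_le fun P _ => ?_
  by_cases hP : P ∈ {P | t < f P}ᶜ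
  · rw [indicator_of_mem hP, ← ofReal_norm, Complex.norm_real, Real.norm_of_nonneg (hf P)]
    exact ENNReal.ofReal_le_ofReal (not_lt.mp hP)
  · rw [indicator_of_notMem hP, enorm_zero]
    exact zero_le

end Outer

namespace Tritile

theorem eq_of_le_of_scale_le {P Q : Tritile} (h : P ≤ Q) (hs : Q.time.scale ≤ P.time.scale) :
    Q = P := by
  have hP := P.area
  have hQ := Q.area
  have hle : P.time.scale ≤ Q.time.scale := by
    have h1 := measure_mono (μ := volume) h.1
    rw [WalshInterval.volume_toSet, WalshInterval.volume_toSet,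
      ENNReal.ofReal_le_ofReal_iff Q.time.length_pos.le] at h1
    exact (zpow_le_zpow_iff_right₀ (by norm_num)).mp h1
  refine Tritile.ext ?_ ?_
  · exact (WalshInterval.eq_of_subset h.1 (by omega)).symm
  · exact WalshInterval.eq_of_subset h.2 (by omega)

/-- Intersecting intervals are nested, and since all tritiles have the same area, the one with the
longer time interval has the shorter frequency interval. -/
theorem le_or_le_of_not_disjoint {P Q : Tritile} (h1 : ¬Disjoint P.time.toSet Q.time.toSet)
    (h2 : ¬Disjoint P.freq.toSet Q.freq.toSet) : P ≤ Q ∨ Q ≤ P := by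
  have hP := P.area
  have hQ := Q.area
  rcases le_total P.time.scale Q.time.scale with hs | hs
  · exact Or.inl ⟨WalshInterval.subset_of_not_disjoint h1 hs,
      WalshInterval.subset_of_not_disjoint (fun h => h2 h.symm) (by omega)⟩
  · exact Or.inr ⟨WalshInterval.subset_of_not_disjoint (fun h => h1 h.symm) hs,
      WalshInterval.subset_of_not_disjoint h2 (by omega)⟩

/-- The maximal elements of a set of tritiles of bounded scale are pairwise disjoint, and their
trees cover the set. -/
theorem exists_maximal_cover (A : Set Tritile) (N : ℤ) (hN : ∀ P ∈ A, P.time.scale ≤ N) :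
    ∃ B ⊆ A, A ⊆ ⋃ P ∈ B, P.tree ∧ ∀ P ∈ B, ∀ Q ∈ B, P ≠ Q →
      Disjoint P.time.toSet Q.time.toSet ∨ Disjoint P.freq.toSet Q.freq.toSet := by
  refine ⟨{Q ∈ A | ∀ Q' ∈ A, Q ≤ Q' → Q' = Q}, fun Q hQ => hQ.1, fun P hP => ?_, ?_⟩
  · obtain ⟨n, ⟨Q, hQA, hPQ, rfl⟩, hmax⟩ := Int.exists_greatest_of_bdd
      (P := fun n => ∃ Q ∈ A, P ≤ Q ∧ Q.time.scale = n)
      ⟨N, by rintro _ ⟨Q, hQ, -, rfl⟩; exact hN Q hQ⟩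
      ⟨_, P, hP, ⟨Subset.rfl, Subset.rfl⟩, rfl⟩
    refine mem_iUnion₂.mpr ⟨Q, ⟨hQA, fun Q' hQ' hle => ?_⟩, hPQ⟩
    exact eq_of_le_of_scale_le hle
      (hmax _ ⟨Q', hQ', ⟨hPQ.1.trans hle.1, hle.2.trans hPQ.2⟩, rfl⟩)
  · intro P hP Q hQ hne
    by_contra h
    rw [not_or] at h
    rcases le_or_le_of_not_disjoint h.1 h.2 with hle | hle
    · exact hne (hP.2 Q hQ.1 hle).symm
    · exact hne (hQ.2 P hP.1 hle)

end Tritile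

/-- The covering bound behind the weak type estimate. -/
theorem IsHilbertian.exists_inducedOuter_levelSet_bound {X : Type u} [NormedAddCommGroup X]
    [NormedSpace ℂ X] [CompleteSpace X] {r : ℝ} (hr : 2 ≤ r) (hX : IsHilbertian.{u, v} r X) :
    ∃ D : ℝ, 0 ≤ D ∧ ∀ f : Walsh → X, IsWalshSchwartz f → ∀ t : ℝ, 0 < t →
      inducedOuter Tritile.tree treePremeasure {P | t < ‖embedding f P‖}
        ≤ ENNReal.ofReal (D * t ^ (-r)) * ∫⁻ y, ‖f y‖ₑ ^ r := by
  have hr0 : 0 < r := by linarith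
  obtain ⟨D, hD, h⟩ := hX.exists_tile_bound hr
  refine ⟨D, hD, fun f hf t ht => ?_⟩
  obtain ⟨N, hN⟩ := pow_unbounded_of_one_lt ((∫ y, ‖f y‖) / t) (by norm_num : (1 : ℝ) < 3)
  obtain ⟨B, hBA, hcover, hdisj⟩ := Tritile.exists_maximal_cover {P | t < ‖embedding f P‖} N
    (fun P hP => by
      obtain ⟨u, hu⟩ := exists_lt_norm_embedding ht.le hP
      have h1 := length_mul_norm_walshPairing_le hf (P.tile u)
      have hl := (P.tile u).time.length_pos
      have h2 : (P.tile u).time.length < 3 ^ (N : ℤ) := by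
        rw [zpow_natCast]
        refine lt_of_le_of_lt ?_ hN
        rw [le_div_iff₀ ht]
        exact (mul_le_mul_of_nonneg_left hu.le hl.le).trans h1
      exact ((zpow_lt_zpow_iff_right₀ (by norm_num)).mp h2).le)
  -- One tile with a large coefficient from each maximal tritile; disjointness passes to these tiles
  -- because they lie inside the tritiles.
  choose u hu using fun P : B => exists_lt_norm_embedding ht.le (hBA P.2)
  have hdisj' : ∀ P Q : B, P ≠ Q → (P.1.tile (u P)).IsDisjoint (Q.1.tile (u Q)) :=
    fun P Q hne => by
      rcases hdisj P P.2 Q Q.2 (fun h => hne (Subtype.ext h)) with h1 | h1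
      · exact Or.inl h1
      · exact Or.inr (h1.mono (WalshInterval.child_subset _ _) (WalshInterval.child_subset _ _))
  refine inducedOuter_le_of_sum_le (fun P => ?_) hcover fun s => ?_
  · exact (ENNReal.ofReal_pos.mpr P.time.length_pos).ne'
  classical
  have hinj : Set.InjOn (fun P : B => P.1.tile (u P)) s := fun P _ Q _ hPQ => by
    by_contra hne
    have h1 := hdisj' P Q hne
    have h2 : P.1.tile (u P) = Q.1.tile (u Q) := hPQ
    rw [h2] at h1
    exact WalshTile.not_isDisjoint_self _ h1
  have key := h f hf (s.image fun P : B => P.1.tile (u P)) (by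
    intro P' hP' Q' hQ' hne
    obtain ⟨P, -, rfl⟩ := Finset.mem_image.mp hP'
    obtain ⟨Q, -, rfl⟩ := Finset.mem_image.mp hQ'
    exact hdisj' P Q fun h => hne (by rw [h]))
  rw [Finset.sum_image hinj] at key
  have h1 : ENNReal.ofReal (t ^ r) * ∑ P ∈ s, treePremeasure P
      ≤ ENNReal.ofReal D * ∫⁻ y, ‖f y‖ₑ ^ r := by
    refine le_trans ?_ key
    rw [Finset.mul_sum]
    refine Finset.sum_le_sum fun P _ => ?_
    rw [mul_comm]
    refine mul_le_mul' le_rfl ?_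
    rw [← ofReal_norm, ENNReal.ofReal_rpow_of_nonneg (norm_nonneg _) hr0.le]
    exact ENNReal.ofReal_le_ofReal (Real.rpow_le_rpow ht.le (hu P).le hr0.le)
  have h2 : ENNReal.ofReal (t ^ (-r)) * ENNReal.ofReal (t ^ r) = 1 := by
    rw [← ENNReal.ofReal_mul (by positivity), ← Real.rpow_add ht, neg_add_cancel, Real.rpow_zero,
      ENNReal.ofReal_one]
  calc _ = ENNReal.ofReal (t ^ (-r)) * (ENNReal.ofReal (t ^ r) * ∑ P ∈ s, treePremeasure P) := by
        rw [← mul_assoc, h2, one_mul]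
    _ ≤ ENNReal.ofReal (t ^ (-r)) * (ENNReal.ofReal D * ∫⁻ y, ‖f y‖ₑ ^ r) := by gcongr
    _ = _ := by
        rw [← mul_assoc, ← ENNReal.ofReal_mul (by positivity), mul_comm D]

/-! ### Marcinkiewicz interpolation and the final estimates -/

theorem lintegral_Ioi_rpow_truncated_le {c s b : ℝ} (hc : 0 ≤ c) (hs : 0 < s) (hb : 0 ≤ b) :
    ∫⁻ t in Ioi (0 : ℝ), (if t / 2 < b then ENNReal.ofReal (c * t ^ (s - 1)) else 0)
      ≤ ENNReal.ofReal (c * (2 * b) ^ s / s) := by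
  have h1 : ∀ t : ℝ, (if t / 2 < b then ENNReal.ofReal (c * t ^ (s - 1)) else 0)
      = (Iio (2 * b)).indicator (fun t => ENNReal.ofReal (c * t ^ (s - 1))) t := fun t => by
    rw [indicator_apply]
    congr 1
    rw [mem_Iio, div_lt_iff₀ two_pos, mul_comm]
  simp only [h1]
  rw [lintegral_indicator measurableSet_Iio, Measure.restrict_restrict measurableSet_Iio]
  have h2 : Iio (2 * b) ∩ Ioi 0 ⊆ Ioc 0 (2 * b) := fun t ht => ⟨ht.2, ht.1.le⟩
  refine (lintegral_mono_set h2).trans (le_of_eq ?_)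
  have hint : IntervalIntegrable (fun t : ℝ => c * t ^ (s - 1)) volume 0 (2 * b) :=
    (intervalIntegral.intervalIntegrable_rpow' (by linarith)).const_mul c
  rw [intervalIntegrable_iff_integrableOn_Ioc_of_le (by positivity)] at hint
  rw [← ofReal_integral_eq_lintegral_ofReal hint, ← intervalIntegral.integral_of_le (by positivity),
    intervalIntegral.integral_const_mul, integral_rpow (Or.inl (by linarith)), sub_add_cancel,
    Real.zero_rpow hs.ne', sub_zero, mul_div_assoc]
  filter_upwards [ae_restrict_mem measurableSet_Ioc] with t ht
  exact mul_nonneg hc (Real.rpow_nonneg ht.1.le _)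

/-- Marcinkiewicz interpolation between a weak type bound at `r` and the trivial bound at `∞`. -/
theorem lintegral_superlevel_le {X : Type*} [NormedAddCommGroup X] [NormedSpace ℂ X]
    {r q D : ℝ} (hr : 0 < r) (hq : r < q) (hD : 0 ≤ D)
    (h : ∀ f : Walsh → X, IsWalshSchwartz f → ∀ t : ℝ, 0 < t →
      inducedOuter Tritile.tree treePremeasure {P | t < ‖embedding f P‖}
        ≤ ENNReal.ofReal (D * t ^ (-r)) * ∫⁻ y, ‖f y‖ₑ ^ r)
    {f : Walsh → X} (hf : IsWalshSchwartz f) :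
    ∫⁻ t in Ioi (0 : ℝ), ENNReal.ofReal (q * t ^ (q - 1)) *
        superlevel Tritile.tree treePremeasure sizeSup (fun P => ((‖embedding f P‖ : ℝ) : ℂ)) t
      ≤ ENNReal.ofReal (q * D * 2 ^ q / (q - r)) * ∫⁻ y, ‖f y‖ₑ ^ q := by
  have hq0 : 0 < q := hr.trans hq
  -- From `q t^(q-1) · D (t/2)^(-r) = c t^(q-r-1)`; a value `x` contributes only for `t < 2‖x‖`, and
  -- `q > r` makes this integrable at `0`.
  set c : ℝ := q * D * 2 ^ r with hc
  have hc0 : 0 ≤ c := by positivity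
  have hpt : ∀ t ∈ Ioi (0 : ℝ), ENNReal.ofReal (q * t ^ (q - 1)) *
      superlevel Tritile.tree treePremeasure sizeSup (fun P => ((‖embedding f P‖ : ℝ) : ℂ)) t
      ≤ ∑ x ∈ hf.values, volume (f ⁻¹' {x}) * ‖x‖ₑ ^ r *
        (if t / 2 < ‖x‖ then ENNReal.ofReal (c * t ^ (q - r - 1)) else 0) := by
    intro t ht
    have ht' : (0 : ℝ) < t := ht
    -- The part of `f` of height at most `t / 2` has embedding at most `t / 2`, so the weak type
    -- bound is needed only for the rest, at height `t / 2`.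
    have h1 := ((superlevel_le_inducedOuter (fun P => norm_nonneg (embedding f P)) t).trans
      (inducedOuter_mono _ _ (levelSet_subset_truncated hf ht'))).trans
      (h _ (hf.indicator_preimage {x | t / 2 < ‖x‖}) (t / 2) (half_pos ht'))
    have h2 : ∀ y, ‖(f ⁻¹' {x | t / 2 < ‖x‖}).indicator f y‖ₑ ^ r
        = {x : X | t / 2 < ‖x‖}.indicator (fun x => ‖x‖ₑ ^ r) (f y) := fun y => by
      by_cases hy : t / 2 < ‖f y‖
      · rw [indicator_of_mem (show y ∈ f ⁻¹' {x | t / 2 < ‖x‖} from hy),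
          indicator_of_mem (show f y ∈ {x : X | t / 2 < ‖x‖} from hy)]
      · rw [indicator_of_notMem (show y ∉ f ⁻¹' {x | t / 2 < ‖x‖} from hy),
          indicator_of_notMem (show f y ∉ {x : X | t / 2 < ‖x‖} from hy), enorm_zero,
          ENNReal.zero_rpow_of_pos hr]
    simp only [h2] at h1
    rw [hf.lintegral_comp (by simp [hr])] at h1
    refine (mul_le_mul' le_rfl h1).trans_eq ?_
    rw [← mul_assoc, ← ENNReal.ofReal_mul (by positivity), Finset.mul_sum]
    refine Finset.sum_congr rfl fun x _ => ?_
    have h3 : q * t ^ (q - 1) * (D * (t / 2) ^ (-r)) = c * t ^ (q - r - 1) := by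
      rw [hc, Real.div_rpow ht'.le zero_le_two, Real.rpow_neg zero_le_two, div_inv_eq_mul]
      have : q - r - 1 = (q - 1) + -r := by ring
      rw [this, Real.rpow_add ht']
      ring
    rw [h3]
    by_cases hx : t / 2 < ‖x‖
    · rw [indicator_of_mem (show x ∈ {x : X | t / 2 < ‖x‖} from hx), if_pos hx, mul_comm]
    · rw [indicator_of_notMem (show x ∉ {x : X | t / 2 < ‖x‖} from hx), if_neg hx]
      simp
  refine (setLIntegral_mono' measurableSet_Ioi hpt).trans ?_
  have hmeas : ∀ x : X, Measurable fun t : ℝ =>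
      if t / 2 < ‖x‖ then ENNReal.ofReal (c * t ^ (q - r - 1)) else 0 := fun x =>
    Measurable.ite (measurableSet_lt (by fun_prop) measurable_const) (by fun_prop)
      measurable_const
  rw [lintegral_finsetSum _ fun x _ => (hmeas x).const_mul _,
    hf.lintegral_comp (G := fun x => ‖x‖ₑ ^ q) (by simp [hq0]), Finset.mul_sum]
  refine Finset.sum_le_sum fun x _ => ?_
  rw [lintegral_const_mul _ (hmeas x), mul_left_comm, mul_assoc]
  refine mul_le_mul' le_rfl ((mul_le_mul' le_rfl
    (lintegral_Ioi_rpow_truncated_le hc0 (sub_pos.mpr hq) (norm_nonneg x))).trans_eq ?_)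
  have hqr : 0 < q - r := sub_pos.mpr hq
  rw [← ofReal_norm, ENNReal.ofReal_rpow_of_nonneg (norm_nonneg _) hr.le,
    ENNReal.ofReal_rpow_of_nonneg (norm_nonneg _) hq0.le, ← ENNReal.ofReal_mul (by positivity),
    ← ENNReal.ofReal_mul (by positivity)]
  congr 1
  rcases (norm_nonneg x).eq_or_lt with h0 | h0
  · rw [← h0, Real.zero_rpow hr.ne', Real.zero_rpow hq0.ne', zero_mul, mul_zero]
  · rw [hc, Real.mul_rpow zero_le_two h0.le, Real.rpow_sub two_pos, Real.rpow_sub h0]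
    field_simp

theorem treeLp_top_embedding_le {X : Type*} [NormedAddCommGroup X] [NormedSpace ℂ X]
    (f : Walsh → X) :
    treeLp ∞ (fun P => ((‖embedding f P‖ : ℝ) : ℂ)) ≤ eLpNorm f ∞ volume := by
  rw [treeLp, outerLp, if_pos rfl]
  refine iSup_le fun T => iSup₂_le fun P _ => ?_
  rw [← ofReal_norm, Complex.norm_real, norm_norm]
  rcases eq_or_ne (eLpNorm f ∞ volume) ∞ with h | h
  · rw [h]
    exact le_top
  refine ENNReal.ofReal_le_of_le_toReal
    ((pi_norm_le_iff_of_nonneg ENNReal.toReal_nonneg).mpr fun u => ?_)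
  have h1 : ‖walshPairing f (P.tile u).wavePacket‖ₑ ≤ eLpNorm f ∞ volume := by
    refine enorm_walshPairing_le ?_ _
    rw [eLpNorm_exponent_top]
    exact enorm_ae_le_eLpNormEssSup f volume
  have h2 := ENNReal.toReal_mono h h1
  rwa [toReal_enorm] at h2

end

theorem theorem5 {X : Type u} [NormedAddCommGroup X] [NormedSpace ℂ X] [CompleteSpace X]
    (r : ℝ) (hr : 2 ≤ r) (hX : IsHilbertian.{u, v} r X) :
    (∀ p : ℝ≥0∞, ENNReal.ofReal r < p →
      ∃ C : NNReal, ∀ f : Walsh → X, IsWalshSchwartz f →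
        treeLp p (fun P => ((‖embedding f P‖ : ℝ) : ℂ)) ≤ C * eLpNorm f p volume) ∧
    (∃ C : NNReal, ∀ f : Walsh → X, IsWalshSchwartz f →
        treeWeakLp r (fun P => ((‖embedding f P‖ : ℝ) : ℂ))
          ≤ C * eLpNorm f (ENNReal.ofReal r) volume) := by
  have hr0 : 0 < r := by linarith
  obtain ⟨D, hD, h⟩ := hX.exists_inducedOuter_levelSet_bound hr
  constructor
  · intro p hp
    rcases eq_or_ne p ∞ with rfl | hp'
    · refine ⟨1, fun f _ => ?_⟩
      rw [ENNReal.coe_one, one_mul]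
      exact treeLp_top_embedding_le f
    · have hq : r < p.toReal := (ENNReal.ofReal_lt_iff_lt_toReal hr0.le hp').mp hp
      have hq0 : 0 < p.toReal := hr0.trans hq
      have hp0 : p ≠ 0 := fun h0 => by simp [h0] at hq0
      refine ⟨(ENNReal.ofReal (p.toReal * D * 2 ^ p.toReal / (p.toReal - r))
        ^ (1 / p.toReal)).toNNReal, fun f hf => ?_⟩
      rw [ENNReal.coe_toNNReal (ENNReal.rpow_ne_top_of_nonneg (by positivity)
        ENNReal.ofReal_ne_top), eLpNorm_eq_lintegral_rpow_enorm_toReal hp0 hp',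
        ← ENNReal.mul_rpow_of_nonneg _ _ (by positivity), treeLp, outerLp, if_neg hp']
      exact ENNReal.rpow_le_rpow (lintegral_superlevel_le hr0 hq hD h hf) (by positivity)
  · refine ⟨(ENNReal.ofReal D ^ (1 / r)).toNNReal, fun f hf => ?_⟩
    rw [ENNReal.coe_toNNReal (ENNReal.rpow_ne_top_of_nonneg (by positivity)
      ENNReal.ofReal_ne_top), eLpNorm_eq_lintegral_rpow_enorm_toReal
        (ENNReal.ofReal_pos.mpr hr0).ne' ENNReal.ofReal_ne_top, ENNReal.toReal_ofReal hr0.le,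
      ← ENNReal.mul_rpow_of_nonneg _ _ (by positivity)]
    refine iSup₂_le fun t ht => ?_
    have ht1 : ENNReal.ofReal t = ENNReal.ofReal (t ^ r) ^ (1 / r) := by
      rw [ENNReal.ofReal_rpow_of_nonneg (by positivity) (by positivity), ← Real.rpow_mul ht.le,
        mul_one_div_cancel hr0.ne', Real.rpow_one]
    rw [ht1, ← ENNReal.mul_rpow_of_nonneg _ _ (by positivity)]
    refine ENNReal.rpow_le_rpow ?_ (by positivity)
    refine (mul_le_mul' le_rfl ((superlevel_le_inducedOuter
      (fun P => norm_nonneg (embedding f P)) t).trans (h f hf t ht))).trans_eq ?_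
    rw [← mul_assoc, ← ENNReal.ofReal_mul (by positivity), mul_left_comm, ← Real.rpow_add ht,
      add_neg_cancel, Real.rpow_zero, mul_one]
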